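/- **Setting.** Let $(K,v)$ be a valued field and let $\Lambda$ be an ordered abelian group containing the value group of $v$. Let $\mathcal T$ be the set of all valuations $\mu\colon K[x]\to\Lambda\cup\{\infty\}$ with $\mu|_K=v$, ordered by $\mu\le\nu$ if and only if $\mu(f)\le\nu(f)$ for all $f\in K[x]$. A node $\mu\in\mathcal T$ is *inner* if it is not maximal in $\mathcal T$. *Key polynomials.* For $\mu\in\mathcal T$ let $\mathcal G_\mu=\bigoplus_\alpha\{g\mid\mu(g)\ge\alpha\}/\{g\mid\mu(g)>\alpha\}$ be its graded algebra and $\operatorname{in}_\mu g\in\mathcal G_\mu$ the initial term of $g\in K[x]$ (the class of $g$ in degree $\mu(g)$, and $0$ if $\mu(g)=\infty$). Write $g\sim_\mu h$ if $\operatorname{in}_\mu g=\operatorname{in}_\mu h$, and $h\mid_\mu g$ if $\operatorname{in}_\mu h\mid\operatorname{in}_\mu g$ in $\mathcal G_\mu$. A *key polynomial* for $\mu$ is a monic $\phi\in K[x]$ such that $(\operatorname{in}_\mu\phi)\,\mathcal G_\mu$ is a nonzero prime ideal and $\phi\nmid_\mu f$ for all nonzero $f$ with $\deg f<\deg\phi$;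 $\operatorname{KP}(\mu)$ is the set of these, which is nonempty if $\mu$ is inner. For an inner node $\mu$ and $\phi\in\operatorname{KP}(\mu)$ of minimal degree put $\deg(\mu)=\deg\phi$ and $\operatorname{sv}(\mu)=\mu(\phi)$ (independent of $\phi$). Let $\Gamma_\mu\subset\Lambda$ be the value group of $\mu$ (generated by the finite values of $\mu$), $\Gamma_\mu^0=\{\mu(a)\mid a\in K[x]\setminus\{0\},\ \deg a<\deg(\mu)\}$, a subgroup of $\Gamma_\mu$, and call $(\Gamma_\mu:\Gamma_\mu^0)$ the *relative ramification index* of $\mu$. *Augmentations.* For $\phi\in\operatorname{KP}(\mu)$ and $\gamma\in\Lambda\cup\{\infty\}$ with $\gamma>\mu(\phi)$, the *ordinary augmentation* $[\mu;\phi,\gamma]\in\mathcal T$ is the valuation that sends $\sum_s a_s\phi^s$, with $\deg a_s<\deg\phi$, to $\min_s\{\mu(a_s)+s\gamma\}$. *Families.* Let $\mathcal C=(\rho_i)_{i\in A}$ be a family of inner nodes indexed by a totally ordered set $A$ without a maximal element, such that $i\mapsto\rho_i$ is strictly increasing. It is *continuous* of stable degree $m(\mathcal C)$ if there is $i_0\in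 A$ with $\deg(\rho_i)=m(\mathcal C)$ for all $i\ge i_0$. For $i<j$ the set of monic polynomials $\varphi$ of minimal degree with $\rho_i(\varphi)<\rho_j(\varphi)$ does not depend on $j$, and is a single $\sim_{\rho_i}$-class in $\operatorname{KP}(\rho_i)$; let $\varphi_i$ be any member. A nonzero $f\in K[x]$ is *$\mathcal C$-stable* if $\varphi_i\nmid_{\rho_i}f$ for some $i\in A$; then $\rho_{\mathcal C}(f)=\max_{i\in A}\rho_i(f)$ exists. The *stable group* of $\mathcal C$ is $\Gamma_{\mathcal C}=\{\rho_{\mathcal C}(f)\mid f\ \mathcal C\text{-stable}\}\subset\Lambda$, and $m_\infty(\mathcal C)\in\mathbb N\cup\{\infty\}$ is the minimal degree of a monic polynomial that is not $\mathcal C$-stable ($\infty$ if there is none). Two such families are *equivalent* if each is cofinal in the other, that is, every node of one is $\le$ some node of the other. **Lemma.** Let $\mathcal C=(\rho_i)_{i\in A}$ be a continuous family with $m(\mathcal C)<m_\infty(\mathcal C)$. Then there is a continuous family $\mathcal B=(\zeta_j)_{j\in B}$ equivalent to $\mathcal C$ such that: 1. $B$ is well-ordered and $\deg(\zeta_j)=m(\mathcal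 C)$ for all $j\in B$; 2. every $\zeta_j$ has relative ramification index equal to one; 3. $\Gamma_{\zeta_j}=\Gamma_{\mathcal B}$ for all $j\in B$; 4. for all $j\in B$ there exists $\chi_j\in\operatorname{KP}(\zeta_j)$ of minimal degree such that, for all $j<k$ in $B$, $\chi_j\not\sim_{\zeta_j}\chi_k$ and $\zeta_k=[\zeta_j;\chi_k,\operatorname{sv}(\zeta_k)]$ (in particular $\chi_k\in\operatorname{KP}(\zeta_j)$ and $\operatorname{sv}(\zeta_k)>\zeta_j(\chi_k)$). -/

import Mathlib

open scoped Polynomial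

universe u w

noncomputable section

namespace ValTree

/-! ## The tree of valuations

`Λ` is an ordered abelian group, `WithTop Λ` is `Λ ∪ {∞}`, and `v` is a valuation on the field `K`
with values in `Λ ∪ {∞}`; the value group of `v` is a subgroup of `Λ`. -/

/-- A node: a valuation `μ : K[x] → Λ ∪ {∞}` whose restriction to `K` is `v`. -/
structure Node {K : Type u} {Λ : Type w} [Field K] [AddCommGroup Λ] [LinearOrder Λ]
    [IsOrderedAddMonoid Λ] (v : AddValuation K (WithTop Λ)) where
  val : AddValuation K[X] (WithTop Λ)
  val_C : ∀ a : K, val (Polynomial.C a) = v a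

section

variable {K : Type u} {Λ : Type w} [Field K] [AddCommGroup Λ] [LinearOrder Λ]
  [IsOrderedAddMonoid Λ] {v : AddValuation K (WithTop Λ)}

instance : CoeFun (Node v) (fun _ => K[X] → WithTop Λ) := ⟨fun μ => μ.val⟩

/-- `μ ≤ ν` means that `μ f ≤ ν f` for all polynomials `f`. -/
instance : PartialOrder (Node v) where
  le μ ν := ∀ f : K[X], μ f ≤ ν f
  le_refl _ _ := le_rfl
  le_trans _ _ _ h₁ h₂ f := (h₁ f).trans (h₂ f)
  le_antisymm μ ν h₁ h₂ := by
    obtain ⟨μ, hμ⟩ := μ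
    obtain ⟨ν, hν⟩ := ν
    have h : μ = ν := AddValuation.ext fun f => le_antisymm (h₁ f) (h₂ f)
    subst h
    rfl

/-- An inner node is a node that is not maximal. -/
def IsInner (μ : Node v) : Prop := ¬ IsMax μ

/-! ## The graded algebra -/

/-- The subring `⊕_α P_α t^α` of `K[x][t^Λ]`, where `P_α = {g | μ g ≥ α}`. -/
def reesRing (μ : Node v) : Subring (AddMonoidAlgebra K[X] Λ) where
  carrier := {F | ∀ α : Λ, (α : WithTop Λ) ≤ μ (F.coeff α)}
  zero_mem' α := by simp
  one_mem' α := by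
    rw [AddMonoidAlgebra.one_def, AddMonoidAlgebra.coeff_single, Finsupp.single_apply]
    split_ifs with h
    · subst h; simp
    · simp
  add_mem' {F G} hF hG α := by
    rw [AddMonoidAlgebra.coeff_add]
    exact AddValuation.map_le_add _ (hF α) (hG α)
  neg_mem' {F} hF α := by
    rw [AddMonoidAlgebra.coeff_neg, Finsupp.neg_apply, AddValuation.map_neg]
    exact hF α
  mul_mem' {F G} hF hG γ := by
    classical
    rw [AddMonoidAlgebra.coeff_mul]
    refine AddValuation.map_le_sum _ fun α _ => ?_
    refine AddValuation.map_le_sum _ fun β _ => ?_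
    dsimp only
    split_ifs with h
    · subst h
      rw [AddValuation.map_mul, WithTop.coe_add]
      exact add_le_add (hF α) (hG β)
    · simp

/-- The ideal `⊕_α P_α⁺ t^α` of `⊕_α P_α t^α`, where `P_α⁺ = {g | μ g > α}`. -/
def reesIdeal (μ : Node v) : Ideal (reesRing μ) where
  carrier := {F | ∀ α : Λ, (α : WithTop Λ) < μ (F.1.coeff α)}
  zero_mem' α := by simp
  add_mem' {F G} hF hG α := by
    rw [Subring.coe_add, AddMonoidAlgebra.coeff_add]
    exact AddValuation.map_lt_add _ (hF α) (hG α)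
  smul_mem' F G hG γ := by
    classical
    rw [smul_eq_mul, Subring.coe_mul, AddMonoidAlgebra.coeff_mul]
    refine AddValuation.map_lt_sum _ WithTop.coe_ne_top fun α _ => ?_
    refine AddValuation.map_lt_sum _ WithTop.coe_ne_top fun β _ => ?_
    dsimp only
    split_ifs with h
    · subst h
      rw [AddValuation.map_mul, WithTop.coe_add]
      exact WithTop.add_lt_add_of_le_of_lt WithTop.coe_ne_top (F.2 α) (hG β)
    · simp

/-- The graded algebra `⊕_α P_α / P_α⁺` of `μ`, realized as the quotient of `⊕_α P_α t^α` by
`⊕_α P_α⁺ t^α`. The index `α` runs over `Λ`: the components at the `α` that are not values of `μ`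
are zero. -/
abbrev GrAlgebra (μ : Node v) : Type (max u w) := reesRing μ ⧸ reesIdeal μ

/-- The homogeneous element `g t^(μ g)` of `⊕_α P_α t^α`, for `g` outside the support of `μ`. -/
def homogeneousLift (μ : Node v) (g : K[X]) (hg : μ g ≠ ⊤) : reesRing μ :=
  ⟨AddMonoidAlgebra.single ((μ g).untop hg) g, fun α => by
    classical
    rw [AddMonoidAlgebra.coeff_single, Finsupp.single_apply]
    split_ifs with h
    · rw [← h, WithTop.coe_untop]
    · simp⟩

open Classical in
/-- The initial term of `g`: the class of `g` in `P_α / P_α⁺` with `α = μ g` if `μ g` is finite,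
and `0` if `g` is in the support of `μ`. -/
def initialTerm (μ : Node v) (g : K[X]) : GrAlgebra μ :=
  if hg : μ g ≠ ⊤ then Ideal.Quotient.mk (reesIdeal μ) (homogeneousLift μ g hg) else 0

/-! ## Key polynomials -/

/-- `g` and `h` are `μ`-equivalent. -/
def MuEquiv (μ : Node v) (g h : K[X]) : Prop := initialTerm μ g = initialTerm μ h

/-- `h ∣_μ g`: `g` is `μ`-divisible by `h`. -/
def MuDvd (μ : Node v) (h g : K[X]) : Prop := initialTerm μ h ∣ initialTerm μ g

/-- `g` is `μ`-irreducible: its initial term generates a nonzero prime ideal. -/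
def MuIrreducible (μ : Node v) (g : K[X]) : Prop :=
  Ideal.span {initialTerm μ g} ≠ ⊥ ∧ (Ideal.span {initialTerm μ g}).IsPrime

/-- `g` is `μ`-minimal. -/
def MuMinimal (μ : Node v) (g : K[X]) : Prop :=
  ∀ f : K[X], f ≠ 0 → f.degree < g.degree → ¬ MuDvd μ g f

/-- The set of Mac Lane–Vaquié key polynomials for `μ`. -/
def KP (μ : Node v) : Set K[X] :=
  {φ | φ.Monic ∧ MuMinimal μ φ ∧ MuIrreducible μ φ}

/-- The key polynomials for `μ` of minimal degree. -/
def minKP (μ : Node v) : Set K[X] :=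
  {φ | φ ∈ KP μ ∧ ∀ ψ ∈ KP μ, φ.natDegree ≤ ψ.natDegree}

/-- The degree of a node that has key polynomials: the minimal degree of a key polynomial.
(For nodes without key polynomials, the leaves, this has the meaningless value `0`; it is
used only for inner nodes.) -/
def deg (μ : Node v) : ℕ := sInf (Polynomial.natDegree '' KP μ)

open Classical in
/-- The singular value of a node that has key polynomials: the value `μ φ` of any key polynomial
`φ` of minimal degree (it does not depend on `φ`). -/
def sv (μ : Node v) : WithTop Λ :=
  if h : (minKP μ).Nonempty then μ h.some else ⊤

/-! ## Value groups -/

/-- The value group of `μ`. -/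
def valueGroup (μ : Node v) : AddSubgroup Λ :=
  AddSubgroup.closure {γ : Λ | ∃ f : K[X], μ f = γ}

/-- The subgroup of the values of the nonzero polynomials of degree smaller than `deg μ`. -/
def valueGroupZero (μ : Node v) : AddSubgroup Λ :=
  AddSubgroup.closure {γ : Λ | ∃ a : K[X], a ≠ 0 ∧ a.natDegree < deg μ ∧ μ a = γ}

/-- The relative ramification index `(Γ_μ : Γ_μ⁰)`, with the usual convention that an infinite
index is `0`. -/
def relRamificationIndex (μ : Node v) : ℕ := (valueGroupZero μ).relIndex (valueGroup μ)

/-! ## Tangent directions and augmentations -/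

/-- The tangent direction of `μ` determined by `ν`: the monic polynomials `φ` of minimal
degree such that `μ φ < ν φ`. -/
def tangentDirection (μ ν : Node v) : Set K[X] :=
  {φ | φ.Monic ∧ μ φ < ν φ ∧ ∀ ψ : K[X], ψ.Monic → μ ψ < ν ψ → φ.natDegree ≤ ψ.natDegree}

/-- `ν = [μ; φ, γ]`: here `φ` is a key polynomial for `μ`, `γ > μ φ`, and `ν` sends
`f = ∑ₛ aₛ φ^s`, with `deg aₛ < deg φ`, to the minimum of the `μ aₛ + s γ`. -/
def IsAugmentation (μ : Node v) (φ : K[X]) (γ : WithTop Λ) (ν : Node v) : Prop :=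
  φ ∈ KP μ ∧ μ φ < γ ∧
    ∀ a : ℕ →₀ K[X], (∀ s, (a s).degree < φ.degree) →
      ν (a.sum fun s b => b * φ ^ s) = a.support.inf fun s => μ (a s) + s • γ

/-! ## Totally ordered families -/

section Families

variable {ι : Type*} [LinearOrder ι] {κ : Type*} [LinearOrder κ]

/-- A totally ordered family of inner nodes without a maximal element; the parametrization is an
isomorphism of ordered sets onto its image. -/
structure IsTotallyOrderedFamily (ρ : ι → Node v) : Prop where
  strictMono : StrictMono ρ
  inner : ∀ i, IsInner (ρ i)
  no_max : ∀ i : ι, ∃ j : ι, i < j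

/-- The degree in the family is eventually constant and equal to `m`. -/
def HasStableDegree (ρ : ι → Node v) (m : ℕ) : Prop :=
  ∃ i₀, ∀ i, i₀ ≤ i → deg (ρ i) = m

/-- A continuous family of stable degree `m`. -/
def IsContinuousFamily (ρ : ι → Node v) (m : ℕ) : Prop :=
  IsTotallyOrderedFamily ρ ∧ HasStableDegree ρ m

/-- The tangent direction of `ρ i` determined by the family: the common value of the tangent
directions of `ρ i` determined by the `ρ j` with `i < j`. -/
def familyTangentDirection (ρ : ι → Node v) (i : ι) : Set K[X] :=
  ⋃ j, ⋃ (_ : i < j), tangentDirection (ρ i) (ρ j)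

/-- The nonzero polynomial `f` is stable: for some `i`, it is not `ρ i`-divisible by the key
polynomials in the tangent direction of `ρ i` determined by the family. -/
def IsStable (ρ : ι → Node v) (f : K[X]) : Prop :=
  f ≠ 0 ∧ ∃ i, ∃ φ ∈ familyTangentDirection ρ i, ¬ MuDvd (ρ i) φ f

/-- `γ` is the stable value of the stable polynomial `f`, the maximum of the values `ρ i f`. -/
def IsStableValue (ρ : ι → Node v) (f : K[X]) (γ : WithTop Λ) : Prop :=
  IsStable ρ f ∧ IsGreatest (Set.range fun i => ρ i f) γ

/-- The stable group of a family: the set of stable values of its stable polynomials. -/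
def stableGroup (ρ : ι → Node v) : Set Λ :=
  {γ : Λ | ∃ f : K[X], IsStableValue ρ f γ}

/-- The limit key polynomials: the monic unstable polynomials of minimal degree. -/
def KPinf (ρ : ι → Node v) : Set K[X] :=
  {φ | φ.Monic ∧ ¬ IsStable ρ φ ∧
    ∀ ψ : K[X], ψ.Monic → ¬ IsStable ρ ψ → φ.natDegree ≤ ψ.natDegree}

/-- The unstable degree: the degree of the limit key polynomials, `∞` if there are none. -/
def unstableDegree (ρ : ι → Node v) : ℕ∞ := ⨅ φ ∈ KPinf ρ, (φ.natDegree : ℕ∞)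

/-- Two families are equivalent if they are cofinal in each other. -/
def FamilyEquiv (ρ : ι → Node v) (ζ : κ → Node v) : Prop :=
  (∀ i, ∃ j, ρ i ≤ ζ j) ∧ ∀ j, ∃ i, ζ j ≤ ρ i

end Families

end

end ValTree

end

namespace ValTree

open Polynomial

section

variable {K : Type u} {Λ : Type w} [Field K] [AddCommGroup Λ] [LinearOrder Λ]
  [IsOrderedAddMonoid Λ] {v : AddValuation K (WithTop Λ)}

/-! Past some index `i₀` all nodes of the family agree in degree `< m`, and the polynomials `φ_i`
have degree `m`. As `m < m_∞`, every monic `χ` of degree `m` is stable and has a finite final value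
`γ χ`. Let `X` be the set of those `χ` whose value rises somewhere past `i₀`, and put `w = ρ i₀`.
The new nodes are the truncations `ζ χ : ∑ aₛ χ^s ↦ min (w aₛ + s γ χ)` for `χ ∈ X`.

If `γ χ < γ χ'`, then `χ' - χ` has degree `< m`, and its value, read off at a late index, is `w (χ'
- χ) = γ χ`. Hence `ζ χ` takes the value `γ χ` at `χ'`, and `ζ χ' = [ζ χ; χ', γ χ']` with `χ` and
`χ'` inequivalent. Moreover `γ χ` is the value of a polynomial of degree `< m`, so the value group
of `ζ χ` is `{w a | a ≠ 0, deg a < m}`: the index is one and the group does not depend on `χ`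
(`exists_val_eq_sv`, `valueGroup_le`). The chain is cofinal with the family, and a cofinal
well-ordered set of values `γ χ` gives the index set.

That `ζ χ` is a valuation is `truncation_mul`. That `χ` is a key polynomial of minimal degree
follows from a node below `ζ χ` and one above it, both with tangent direction `χ`, through
`tangentDirection_subset_KP` and `natDegree_le_of_mem_KP`. -/

/-! ### Initial terms and the graded algebra -/

theorem mem_span_of_dvd {R : Type*} [CommRing R] (I : Ideal R) {x y : R ⧸ I} (h : x ∣ y) :
    y ∈ Ideal.span {x} := by
  obtain ⟨z, rfl⟩ := h
  exact Ideal.mem_span_singleton.2 ⟨z, rfl⟩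

theorem mem_reesIdeal {μ : Node v} {F : reesRing μ} :
    F ∈ reesIdeal μ ↔ ∀ α : Λ, (α : WithTop Λ) < μ (F.1.coeff α) := Iff.rfl

/-- The homogeneous element `g t^α` of the Rees ring, for `α ≤ μ g`. -/
noncomputable def homogeneousElement (μ : Node v) (α : Λ) (g : K[X]) (h : (α : WithTop Λ) ≤ μ g) :
    reesRing μ :=
  ⟨AddMonoidAlgebra.single α g, fun β => by
    classical
    rw [AddMonoidAlgebra.coeff_single, Finsupp.single_apply]
    split_ifs with hβ
    · rwa [← hβ]
    · simp⟩

theorem coe_homogeneousElement {μ : Node v} {α : Λ} {g : K[X]} {h : (α : WithTop Λ) ≤ μ g} :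
    (homogeneousElement μ α g h : AddMonoidAlgebra K[X] Λ) = AddMonoidAlgebra.single α g := rfl

theorem homogeneousElement_mem {μ : Node v} {α : Λ} {g : K[X]} {h : (α : WithTop Λ) ≤ μ g} :
    homogeneousElement μ α g h ∈ reesIdeal μ ↔ (α : WithTop Λ) < μ g := by
  classical
  rw [mem_reesIdeal]
  simp only [coe_homogeneousElement, AddMonoidAlgebra.coeff_single, Finsupp.single_apply]
  refine ⟨fun H => by simpa using H α, fun H β => ?_⟩
  split_ifs with hβ
  · rwa [← hβ]
  · simp

theorem initialTerm_of_eq {μ : Node v} {g : K[X]} {α : Λ} (h : μ g = α) :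
    initialTerm μ g = Ideal.Quotient.mk (reesIdeal μ) (homogeneousElement μ α g h.ge) := by
  have hg : μ g ≠ ⊤ := by rw [h]; exact WithTop.coe_ne_top
  rw [initialTerm, dif_pos hg]
  congr 1
  apply Subtype.ext
  simp [homogeneousLift, homogeneousElement, h]

theorem initialTerm_of_top {μ : Node v} {g : K[X]} (h : μ g = ⊤) : initialTerm μ g = 0 := by
  rw [initialTerm, dif_neg (by simpa using h)]

theorem initialTerm_eq_zero_iff {μ : Node v} {g : K[X]} : initialTerm μ g = 0 ↔ μ g = ⊤ := by
  refine ⟨fun h => ?_, initialTerm_of_top⟩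
  by_contra hg
  obtain ⟨α, hα⟩ := WithTop.ne_top_iff_exists.1 hg
  rw [initialTerm_of_eq hα.symm, Ideal.Quotient.eq_zero_iff_mem, homogeneousElement_mem, ← hα] at h
  exact lt_irrefl _ h

theorem initialTerm_one {μ : Node v} : initialTerm μ 1 = 1 := by
  rw [initialTerm_of_eq (α := 0) (by rw [AddValuation.map_one]; rfl), ← map_one (Ideal.Quotient.mk _)]
  rfl

theorem initialTerm_mul {μ : Node v} (g h : K[X]) :
    initialTerm μ (g * h) = initialTerm μ g * initialTerm μ h := by
  by_cases hg : μ g = ⊤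
  · rw [initialTerm_of_top hg, zero_mul, initialTerm_of_top]
    rw [AddValuation.map_mul, hg, top_add]
  by_cases hh : μ h = ⊤
  · rw [initialTerm_of_top hh, mul_zero, initialTerm_of_top]
    rw [AddValuation.map_mul, hh, add_top]
  obtain ⟨α, hα⟩ := WithTop.ne_top_iff_exists.1 hg
  obtain ⟨β, hβ⟩ := WithTop.ne_top_iff_exists.1 hh
  have hm : μ (g * h) = ((α + β : Λ) : WithTop Λ) := by
    rw [AddValuation.map_mul, ← hα, ← hβ, WithTop.coe_add]
  rw [initialTerm_of_eq hα.symm, initialTerm_of_eq hβ.symm, initialTerm_of_eq hm, ← map_mul]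
  congr 1
  apply Subtype.ext
  simp [homogeneousElement]

theorem initialTerm_eq_of_lt_sub {μ : Node v} {g h : K[X]} (H : μ g < μ (g - h)) :
    initialTerm μ g = initialTerm μ h := by
  have hgh : μ g = μ h := by
    refine (AddValuation.map_eq_of_lt_sub _ ?_).symm
    rwa [AddValuation.map_sub_swap]
  obtain ⟨α, hα⟩ := WithTop.ne_top_iff_exists.1 H.ne_top
  rw [initialTerm_of_eq hα.symm, initialTerm_of_eq (hα.trans hgh).symm, Ideal.Quotient.eq]
  rw [← hα] at H
  convert (homogeneousElement_mem (h := H.le)).2 H using 1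
  apply Subtype.ext
  simp [homogeneousElement, AddMonoidAlgebra.single_sub]

theorem lt_sub_of_muEquiv {μ : Node v} {g h : K[X]} (H : MuEquiv μ g h) (hg : μ g ≠ ⊤) :
    μ g < μ (g - h) := by
  classical
  have hh : μ h ≠ ⊤ := fun hh => hg <| by
    rw [MuEquiv, initialTerm_of_top hh, initialTerm_eq_zero_iff] at H
    exact H
  obtain ⟨α, hα⟩ := WithTop.ne_top_iff_exists.1 hg
  obtain ⟨β, hβ⟩ := WithTop.ne_top_iff_exists.1 hh
  rw [MuEquiv, initialTerm_of_eq hα.symm, initialTerm_of_eq hβ.symm, Ideal.Quotient.eq,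
    mem_reesIdeal] at H
  have := H α
  simp only [AddSubgroupClass.coe_sub, coe_homogeneousElement, AddMonoidAlgebra.coeff_sub, Finsupp.sub_apply,
    AddMonoidAlgebra.coeff_single, Finsupp.single_apply, if_true] at this
  split_ifs at this with hαβ
  · rwa [← hα]
  · rw [sub_zero, hα] at this
    exact absurd this (lt_irrefl _)

/-- The cofactor in the graded algebra may be inhomogeneous, but only its component in degree `μ g -
μ h` matters; `q` represents that component. -/
theorem MuDvd.exists_lt {μ : Node v} {h g : K[X]} (H : MuDvd μ h g) (hg : μ g ≠ ⊤) :
    ∃ q, μ g < μ (g - h * q) := by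
  classical
  obtain ⟨X, hX⟩ := H
  obtain ⟨α, hα⟩ := WithTop.ne_top_iff_exists.1 hg
  by_cases hh : μ h = ⊤
  · rw [initialTerm_of_top hh, zero_mul, initialTerm_eq_zero_iff] at hX
    exact absurd hX hg
  obtain ⟨β, hβ⟩ := WithTop.ne_top_iff_exists.1 hh
  obtain ⟨Y, rfl⟩ := Ideal.Quotient.mk_surjective X
  rw [initialTerm_of_eq hα.symm, initialTerm_of_eq hβ.symm, ← map_mul, Ideal.Quotient.eq,
    mem_reesIdeal] at hX
  refine ⟨Y.1.coeff (α - β), ?_⟩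
  have := hX α
  simp only [AddSubgroupClass.coe_sub, coe_homogeneousElement, AddMonoidAlgebra.coeff_sub, Finsupp.sub_apply,
    AddMonoidAlgebra.coeff_single, Finsupp.single_apply, if_true, Subring.coe_mul] at this
  rw [AddMonoidAlgebra.coeff_single_mul_eq_mul_coeff (α - β)] at this
  · rwa [← hα]
  · intro m' _
    rw [eq_sub_iff_add_eq', eq_comm]

theorem muDvd_of_lt {μ : Node v} {h g q : K[X]} (H : μ g < μ (g - h * q)) : MuDvd μ h g :=
  ⟨initialTerm μ q, by rw [← initialTerm_mul]; exact initialTerm_eq_of_lt_sub H⟩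

theorem not_muDvd_one {μ : Node v} {φ : K[X]} (hφ : φ ∈ KP μ) : ¬ MuDvd μ φ 1 := by
  intro h
  refine hφ.2.2.2.ne_top ?_
  rw [MuDvd, initialTerm_one] at h
  exact (Ideal.eq_top_iff_one _).2 (mem_span_of_dvd _ h)

/-- The graded algebra of a node is a domain. -/
theorem reesIdeal_isPrime (μ : Node v) : (reesIdeal μ).IsPrime := by
  classical
  refine ⟨fun h => ?_, fun {F G} hFG => ?_⟩
  · have h1 : (1 : reesRing μ) ∈ reesIdeal μ := h ▸ Submodule.mem_top
    have := h1 0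
    rw [Subring.coe_one, AddMonoidAlgebra.one_def, AddMonoidAlgebra.coeff_single] at this
    simp at this
  · by_contra hcon
    rw [not_or] at hcon
    -- `α` is the largest degree in which `F` has a nonzero class.
    have key : ∀ F : reesRing μ, F ∉ reesIdeal μ →
        ∃ α : Λ, μ (F.1.coeff α) = α ∧ ∀ β, α < β → (β : WithTop Λ) < μ (F.1.coeff β) := by
      intro F hF
      let s := F.1.coeff.support.filter fun α => μ (F.1.coeff α) = α
      have hs : ∀ α, α ∈ s ↔ μ (F.1.coeff α) = α := fun α => by
        simp only [s, Finset.mem_filter, Finsupp.mem_support_iff, and_iff_right_iff_imp]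
        intro h h0
        rw [h0, AddValuation.map_zero] at h
        exact WithTop.coe_ne_top h.symm
      have hne : s.Nonempty := by
        rw [mem_reesIdeal] at hF
        push Not at hF
        obtain ⟨α, hα⟩ := hF
        exact ⟨α, (hs α).2 (le_antisymm hα (F.2 α))⟩
      refine ⟨s.max' hne, (hs _).1 (s.max'_mem hne), fun β hβ => ?_⟩
      refine lt_of_le_of_ne (F.2 β) fun h => ?_
      exact absurd (s.le_max' β ((hs β).2 h.symm)) (not_le.2 hβ)
    obtain ⟨α, hα, hα'⟩ := key F hcon.1
    obtain ⟨β, hβ, hβ'⟩ := key G hcon.2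
    have h1 := hFG (α + β)
    -- In any other contribution to degree `α + β`, one index exceeds `α` or `β`, so that factor has
    -- excess value.
    have h2 : ((α + β : Λ) : WithTop Λ) <
        μ ((F * G).1.coeff (α + β) - F.1.coeff α * G.1.coeff β) := by
      have : (F * G).1.coeff (α + β) - F.1.coeff α * G.1.coeff β =
          ∑ a ∈ F.1.coeff.support, ∑ b ∈ G.1.coeff.support,
            if a + b = α + β ∧ ¬ (a = α ∧ b = β) then F.1.coeff a * G.1.coeff b else 0 := by
        have hne : ∀ (H : reesRing μ) (c : Λ), μ (H.1.coeff c) = c → c ∈ H.1.coeff.support := by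
          intro H c hc
          rw [Finsupp.mem_support_iff]
          intro h0
          rw [h0, AddValuation.map_zero] at hc
          exact WithTop.coe_ne_top hc.symm
        have h3 : F.1.coeff α * G.1.coeff β =
            ∑ a ∈ F.1.coeff.support, ∑ b ∈ G.1.coeff.support,
              if a = α ∧ b = β then F.1.coeff a * G.1.coeff b else 0 := by
          simp only [ite_and]
          rw [Finset.sum_eq_single α, Finset.sum_eq_single β]
          · simp
          · intro b _ hb; simp [hb]
          · intro h; exact absurd (hne G β hβ) h
          · intro a _ ha; simp [ha]
          · intro h; exact absurd (hne F α hα) h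
        rw [Subring.coe_mul, AddMonoidAlgebra.coeff_mul, h3, Finsupp.sum, ← Finset.sum_sub_distrib]
        refine Finset.sum_congr rfl fun a _ => ?_
        rw [Finsupp.sum, ← Finset.sum_sub_distrib]
        refine Finset.sum_congr rfl fun b _ => ?_
        by_cases h4 : a = α ∧ b = β
        · obtain ⟨rfl, rfl⟩ := h4; simp
        · simp [h4]
      rw [this]
      refine AddValuation.map_lt_sum _ WithTop.coe_ne_top fun a _ => ?_
      refine AddValuation.map_lt_sum _ WithTop.coe_ne_top fun b _ => ?_
      split_ifs with h
      · rw [AddValuation.map_mul, ← h.1, WithTop.coe_add]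
        rcases lt_trichotomy a α with hlt | heq | hgt
        · have : β < b := by
            by_contra hb
            exact absurd h.1 (add_lt_add_of_lt_of_le hlt (not_lt.1 hb)).ne
          exact WithTop.add_lt_add_of_le_of_lt WithTop.coe_ne_top (F.2 a) (hβ' b this)
        · exact absurd ⟨heq, by have := h.1; rw [heq] at this; exact add_left_cancel this⟩ h.2
        · exact WithTop.add_lt_add_of_lt_of_le WithTop.coe_ne_top (hα' a hgt) (G.2 b)
      · simp
    have h5 := AddValuation.map_lt_add μ.val h1 ((AddValuation.map_neg μ.val _).symm ▸ h2)
    rw [← sub_eq_add_neg, sub_sub_cancel, AddValuation.map_mul, hα, hβ, ← WithTop.coe_add] at h5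
    exact lt_irrefl _ h5

theorem reesRing_mono {μ ν : Node v} (h : μ ≤ ν) : reesRing μ ≤ reesRing ν :=
  fun _ hF α => (hF α).trans (h _)

/-- If `φ` divides, for `μ`, exactly the polynomials whose value increases from `μ` to `ν`, then
the initial term of `φ` generates the kernel of the map between the graded algebras. -/
theorem muIrreducible_of_dvd_iff {μ ν : Node v} (hle : μ ≤ ν) {φ : K[X]} (hφ : μ φ < ν φ)
    (H : ∀ f, μ f < ν f → MuDvd μ φ f) : MuIrreducible μ φ := by
  classical
  obtain ⟨γ, hγ⟩ := WithTop.ne_top_iff_exists.1 hφ.ne_top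
  have hpr := reesIdeal_isPrime ν
  -- `J` is the kernel of the map to the graded algebra of `ν`, a domain, hence prime. It is
  -- homogeneous, so its generation can be checked on components.
  set J : Ideal (reesRing μ) := (reesIdeal ν).comap (Subring.inclusion (reesRing_mono hle)) with hJ
  have hJp : J.IsPrime := Ideal.comap_isPrime _ _
  have hmem : ∀ F : reesRing μ, F ∈ J ↔ ∀ α : Λ, (α : WithTop Λ) < ν (F.1.coeff α) :=
    fun F => Iff.rfl
  have hker : RingHom.ker (Ideal.Quotient.mk (reesIdeal μ)) ≤ J := by
    rw [Ideal.mk_ker]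
    exact fun F hF α => (hF α).trans_le (hle _)
  have hmap := Ideal.map_isPrime_of_surjective (Ideal.Quotient.mk_surjective (I := reesIdeal μ)) hker
  suffices h : J.map (Ideal.Quotient.mk (reesIdeal μ)) = Ideal.span {initialTerm μ φ} by
    refine ⟨?_, h ▸ hmap⟩
    rw [Ne, Ideal.span_singleton_eq_bot, initialTerm_eq_zero_iff]
    exact hφ.ne_top
  apply le_antisymm
  · rw [Ideal.map_le_iff_le_comap]
    intro F hF
    rw [hmem] at hF
    have hsum : F = ∑ α ∈ F.1.coeff.support, homogeneousElement μ α (F.1.coeff α) (F.2 α) := by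
      apply Subtype.ext
      rw [AddSubmonoidClass.coe_finsetSum]
      exact (AddMonoidAlgebra.sum_coeff_single F.1).symm
    rw [hsum]
    refine Ideal.sum_mem _ fun α _ => ?_
    rw [Ideal.mem_comap]
    rcases (F.2 α).lt_or_eq with h | h
    · have h0 : homogeneousElement μ α (F.1.coeff α) (F.2 α) ∈ reesIdeal μ :=
        homogeneousElement_mem.2 h
      rw [Ideal.Quotient.eq_zero_iff_mem.2 h0]
      exact Ideal.zero_mem _
    · have hX : MuDvd μ φ (F.1.coeff α) := H _ (h.symm.trans_lt (hF α))
      rw [MuDvd, initialTerm_of_eq h.symm] at hX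
      exact mem_span_of_dvd _ hX
  · rw [Ideal.span_le, Set.singleton_subset_iff, initialTerm_of_eq hγ.symm]
    refine Ideal.mem_map_of_mem _ ?_
    rw [hmem]
    intro α
    simp only [coe_homogeneousElement, AddMonoidAlgebra.coeff_single, Finsupp.single_apply]
    split_ifs with h
    · rwa [← h, hγ]
    · simp

/-! ### Tangent directions and key polynomials -/

theorem add_lt_add_of_ne_top {a b c d : WithTop Λ} (ha : a ≠ ⊤) (hac : a ≤ c) (hbd : b < d) :
    a + b < c + d :=
  WithTop.add_lt_add_of_le_of_lt ha hac hbd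

theorem exists_monic_lt {μ ν : Node v} {f : K[X]} (h : μ f < ν f) :
    ∃ g : K[X], g.Monic ∧ g.natDegree = f.natDegree ∧ μ g < ν g := by
  have hf : f ≠ 0 := by
    rintro rfl
    rw [AddValuation.map_zero, AddValuation.map_zero] at h
    exact lt_irrefl _ h
  have hc : f.leadingCoeff⁻¹ ≠ 0 := inv_ne_zero (leadingCoeff_ne_zero.2 hf)
  refine ⟨f * C f.leadingCoeff⁻¹, monic_mul_leadingCoeff_inv hf, ?_, ?_⟩
  · rw [natDegree_mul_C hc]
  · rw [AddValuation.map_mul, AddValuation.map_mul, μ.val_C, ν.val_C, add_comm, add_comm (ν.val f)]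
    exact add_lt_add_of_ne_top ((AddValuation.ne_top_iff v).2 hc) le_rfl h

theorem val_eq_of_degree_lt {μ ν : Node v} (hle : μ ≤ ν) {φ : K[X]}
    (h : φ ∈ tangentDirection μ ν) {f : K[X]} (hf : f.degree < φ.degree) : μ f = ν f := by
  by_contra hne
  obtain ⟨g, hg, hgf, hlt⟩ := exists_monic_lt (lt_of_le_of_ne (hle f) hne)
  have := h.2.2 g hg hlt
  rw [hgf] at this
  have hf0 : f ≠ 0 := fun h0 => hne (by rw [h0, AddValuation.map_zero, AddValuation.map_zero])
  rw [degree_eq_natDegree h.1.ne_zero, ← natDegree_lt_iff_degree_lt hf0] at hf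
  omega

theorem exists_lt_of_lt {μ ν : Node v} (h : μ < ν) : ∃ f, μ f < ν f := by
  by_contra! hcon
  exact absurd (show ν ≤ μ from hcon) (not_le_of_gt h)

theorem tangentDirection_nonempty {μ ν : Node v} (h : μ < ν) :
    (tangentDirection μ ν).Nonempty := by
  classical
  obtain ⟨f, hf⟩ := exists_lt_of_lt h
  obtain ⟨g, hg, -, hlt⟩ := exists_monic_lt hf
  have hex : ∃ n, ∃ ψ : K[X], ψ.Monic ∧ μ ψ < ν ψ ∧ ψ.natDegree = n := ⟨_, g, hg, hlt, rfl⟩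
  obtain ⟨ψ, h1, h2, h3⟩ := Nat.find_spec hex
  exact ⟨ψ, h1, h2, fun χ hχ hχ' => h3 ▸ Nat.find_min' hex ⟨χ, hχ, hχ', rfl⟩⟩

/-- Proper monic factors have smaller degree, so their values do not change from `μ` to `ν`; neither
would the value of their product. -/
theorem tangentDirection_irreducible {μ ν : Node v} (hle : μ ≤ ν) {φ : K[X]}
    (h : φ ∈ tangentDirection μ ν) : Irreducible φ := by
  rw [h.1.irreducible_iff_natDegree']
  refine ⟨?_, fun f g hf hg hfg hn => ?_⟩
  · rintro rfl
    have := h.2.1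
    rw [AddValuation.map_one, AddValuation.map_one] at this
    exact lt_irrefl _ this
  · rw [Finset.mem_Ioc] at hn
    have hd : f.natDegree + g.natDegree = φ.natDegree := by rw [← hfg, hf.natDegree_mul hg]
    have h1 : μ f = ν f := val_eq_of_degree_lt hle h
      (degree_lt_degree (by omega))
    have h2 : μ g = ν g := val_eq_of_degree_lt hle h
      (degree_lt_degree (by omega))
    have := h.2.1
    rw [← hfg, AddValuation.map_mul, AddValuation.map_mul, h1, h2] at this
    exact lt_irrefl _ this

theorem one_le_natDegree_of_mem_tangentDirection {μ ν : Node v} (hle : μ ≤ ν) {φ : K[X]}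
    (h : φ ∈ tangentDirection μ ν) : 1 ≤ φ.natDegree :=
  (tangentDirection_irreducible hle h).natDegree_pos

theorem exists_bezout {μ ν : Node v} (hle : μ ≤ ν) {φ : K[X]} (h : φ ∈ tangentDirection μ ν)
    {f : K[X]} (hf : ¬ φ ∣ f) : ∃ a b : K[X], a.degree < φ.degree ∧ a * f + b * φ = 1 := by
  obtain ⟨b, a, hab⟩ := ((tangentDirection_irreducible hle h).coprime_iff_not_dvd).2 hf
  refine ⟨a %ₘ φ, b + (a /ₘ φ) * f, degree_modByMonic_lt _ h.1, ?_⟩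
  have := modByMonic_add_div a φ
  rw [← hab]
  nth_rewrite 3 [← this]
  ring

/-- The support of a node that is not maximal is zero. -/
theorem val_ne_top_of_lt {μ ν : Node v} (hlt : μ < ν) {f : K[X]} (hf : f ≠ 0) : μ f ≠ ⊤ := by
  obtain ⟨φ, h⟩ := tangentDirection_nonempty hlt
  have hpos := one_le_natDegree_of_mem_tangentDirection hlt.le h
  induction hn : f.natDegree using Nat.strong_induction_on generalizing f with
  | _ n ih =>
  intro htop
  by_cases hdvd : φ ∣ f
  · obtain ⟨g, rfl⟩ := hdvd
    have hg : g ≠ 0 := right_ne_zero_of_mul hf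
    rw [AddValuation.map_mul, WithTop.add_eq_top] at htop
    rw [natDegree_mul h.1.ne_zero hg] at hn
    exact ih g.natDegree (by omega) hg rfl (htop.resolve_left h.2.1.ne_top)
  -- Here `a * f` has value `∞` at both nodes, which forces `b * φ` to have value `0` at both,
  -- although `φ` gains value.
  · obtain ⟨a, b, -, hab⟩ := exists_bezout hlt.le h hdvd
    have h1 : μ (a * f) = ⊤ := by rw [AddValuation.map_mul, htop, add_top]
    have h2 : ν (a * f) = ⊤ := top_le_iff.1 (h1 ▸ hlt.le (a * f))
    have h3 : ∀ η : Node v, η (a * f) = ⊤ → η (b * φ) = 0 := by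
      intro η hη
      have h0 : η (a * f + b * φ) = 0 := by rw [hab, AddValuation.map_one]
      rw [← h0]
      by_contra hne
      have hlt : η (b * φ) < η (a * f) := by
        refine lt_top_iff_ne_top.2 (fun hb => ?_) |>.trans_eq hη.symm
        have : (⊤ : WithTop Λ) ≤ η (a * f + b * φ) := AddValuation.map_le_add _ hη.ge hb.ge
        rw [h0, top_le_iff] at this
        exact WithTop.zero_ne_top this
      exact hne (AddValuation.map_add_eq_of_lt_right η.val hlt).symm
    have h4 := h3 μ h1
    have h5 := h3 ν h2
    rw [AddValuation.map_mul] at h4 h5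
    have hb : μ b ≠ ⊤ := by
      intro hb
      rw [hb, top_add] at h4
      exact WithTop.top_ne_zero h4
    have := add_lt_add_of_ne_top hb (hlt.le b) h.2.1
    rw [h4, h5] at this
    exact lt_irrefl _ this

theorem MuDvd.val_lt {μ ν : Node v} (hle : μ ≤ ν) {φ f : K[X]} (hφ : μ φ < ν φ)
    (H : MuDvd μ φ f) (hf : μ f ≠ ⊤) : μ f < ν f := by
  obtain ⟨q, hq⟩ := H.exists_lt hf
  have h1 : μ (φ * q) = μ f := by
    refine AddValuation.map_eq_of_lt_sub _ ?_
    rwa [AddValuation.map_sub_swap]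
  have h2 : μ f < ν (φ * q) := by
    rw [← h1, AddValuation.map_mul, AddValuation.map_mul, add_comm, add_comm (ν.val φ)]
    refine add_lt_add_of_ne_top ?_ (hle q) hφ
    intro hq
    rw [AddValuation.map_mul, hq, add_top] at h1
    exact hf h1.symm
  have h3 := AddValuation.map_lt_add ν.val (hq.trans_le (hle _)) h2
  rwa [sub_add_cancel] at h3

/-- Cancellation is impossible: at `ν` the term `r` keeps its value while `φ * q` gains, so the sum
would have `ν`-value `μ r`, below its `μ`-value. -/
theorem val_add_mul {μ ν : Node v} (hle : μ ≤ ν) {φ : K[X]} (h : φ ∈ tangentDirection μ ν)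
    {r q : K[X]} (hr : r.degree < φ.degree) : μ (r + φ * q) = min (μ r) (μ φ + μ q) := by
  rw [← AddValuation.map_mul]
  refine le_antisymm ?_ (AddValuation.map_add _ _ _)
  by_contra! hlt
  have heq : μ r = μ (φ * q) := by
    by_contra hne
    exact hlt.ne' (AddValuation.map_add_of_distinct_val _ hne)
  rw [heq, min_self] at hlt
  have hq : μ q ≠ ⊤ := by
    intro hq
    rw [AddValuation.map_mul, hq, add_top] at hlt
    exact not_top_lt hlt
  have h1 : ν r < ν (φ * q) := by
    rw [← val_eq_of_degree_lt hle h hr, heq, AddValuation.map_mul, AddValuation.map_mul, add_comm,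
      add_comm (ν.val φ)]
    exact add_lt_add_of_ne_top hq (hle q) h.2.1
  have h2 := AddValuation.map_add_eq_of_lt_left _ h1
  rw [← val_eq_of_degree_lt hle h hr, heq] at h2
  exact absurd (h2.trans_lt hlt) (not_lt.2 (hle _))

/-- If the remainder of `f` modulo `φ` had value `μ f`, it would keep it at `ν` while the multiple
of `φ` rises above it, and `f` would not gain value. -/
theorem muDvd_of_val_lt {μ ν : Node v} (hle : μ ≤ ν) {φ : K[X]} (h : φ ∈ tangentDirection μ ν)
    {f : K[X]} (hf : μ f < ν f) : MuDvd μ φ f := by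
  have hdeg := degree_modByMonic_lt f h.1
  have hdiv := modByMonic_add_div f φ
  refine muDvd_of_lt (q := f /ₘ φ) ?_
  have hsub : f - φ * (f /ₘ φ) = f %ₘ φ := by rw [sub_eq_iff_eq_add]; exact hdiv.symm
  rw [hsub]
  have hmin : μ f = min (μ (f %ₘ φ)) (μ φ + μ (f /ₘ φ)) := by
    rw [← val_add_mul hle h hdeg, hdiv]
  have hle' : μ f ≤ μ (f %ₘ φ) := hmin ▸ min_le_left _ _
  refine lt_of_le_of_ne hle' fun heq => ?_
  have h1 : μ f ≤ μ φ + μ (f /ₘ φ) := hmin ▸ min_le_right _ _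
  have h2 : μ f < ν (φ * (f /ₘ φ)) := by
    rw [AddValuation.map_mul]
    by_cases hq : μ (f /ₘ φ) = ⊤
    · rw [top_le_iff.1 (hq.ge.trans (hle (f /ₘ φ))), add_top]
      exact hf.ne_top.lt_top
    · refine h1.trans_lt ?_
      rw [add_comm, add_comm (ν.val φ)]
      exact add_lt_add_of_ne_top hq (hle _) h.2.1
  have h3 : ν (f %ₘ φ) < ν (φ * (f /ₘ φ)) := by
    rwa [← val_eq_of_degree_lt hle h hdeg, ← heq]
  have h4 := AddValuation.map_add_eq_of_lt_left _ h3
  rw [hdiv, ← val_eq_of_degree_lt hle h hdeg, ← heq] at h4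
  exact hf.ne' h4

/-- Divisibility by `φ` amounts to gaining value from `μ` to `ν`. This is membership in a prime
kernel, and it never happens in degree below that of `φ`. -/
theorem tangentDirection_subset_KP {μ ν : Node v} (hlt : μ < ν) :
    tangentDirection μ ν ⊆ KP μ := by
  intro φ h
  refine ⟨h.1, fun f hf hdeg hdvd => ?_,
    muIrreducible_of_dvd_iff hlt.le h.2.1 fun f hf => muDvd_of_val_lt hlt.le h hf⟩
  exact (hdvd.val_lt hlt.le h.2.1 (val_ne_top_of_lt hlt hf)).ne (val_eq_of_degree_lt hlt.le h hdeg)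

/-- Polynomials of degree smaller than that of a tangent direction from below have invertible
initial terms. -/
theorem exists_inverse {μ ν : Node v} (hle : μ ≤ ν) {φ : K[X]} (h : φ ∈ tangentDirection μ ν)
    {f : K[X]} (hf : f ≠ 0) (hdeg : f.degree < φ.degree) :
    ∃ a : K[X], a.degree < φ.degree ∧ 0 < ν (1 - f * a) := by
  obtain ⟨a, b, ha, hab⟩ := exists_bezout hle h
    (h.1.not_dvd_of_degree_lt hf hdeg)
  refine ⟨a, ha, ?_⟩
  have hsub : 1 - f * a = b * φ := by rw [← hab]; ring
  rw [hsub]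
  -- If `ν (b * φ) ≤ 0`, then `μ (b * φ) < 0` must be cancelled by `a * f`, whose value is the same
  -- at `ν`; there `a * f` alone determines the value of `1`, giving `0 = ν (a * f) < ν (b * φ)`.
  by_contra! hcon
  have haf : μ (a * f) = ν (a * f) := by
    rw [AddValuation.map_mul, AddValuation.map_mul, val_eq_of_degree_lt hle h ha,
      val_eq_of_degree_lt hle h hdeg]
  have hlt : μ (b * φ) < ν (b * φ) := by
    rw [AddValuation.map_mul, AddValuation.map_mul]
    refine add_lt_add_of_ne_top (fun hb => ?_) (hle b) h.2.1
    have : ν (b * φ) = ⊤ := by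
      rw [AddValuation.map_mul, top_le_iff.1 (hb.ge.trans (hle b)), top_add]
    rw [this, top_le_iff] at hcon
    exact WithTop.zero_ne_top hcon
  have hμ : μ (b * φ) = μ (a * f) := by
    have h1 : μ (b * φ) < μ (a * f + b * φ) := by
      rw [hab, AddValuation.map_one]
      exact hlt.trans_le hcon
    by_contra hne
    rw [AddValuation.map_add_of_distinct_val _ (Ne.symm hne)] at h1
    rcases lt_or_gt_of_ne hne with h2 | h2
    · rw [min_eq_right h2.le] at h1
      exact lt_irrefl _ h1
    · rw [min_eq_left h2.le] at h1
      exact lt_asymm h1 h2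
  have h2 : ν (a * f) < ν (b * φ) := by rwa [← haf, ← hμ]
  have h3 := AddValuation.map_add_eq_of_lt_left _ h2
  rw [hab, AddValuation.map_one] at h3
  exact absurd hcon (not_le.2 (h3.trans_lt h2))

/-- In smaller degree the initial term at `ν` is a unit, which generates no prime ideal. -/
theorem natDegree_le_of_mem_KP {μ ν : Node v} (hle : μ ≤ ν) {φ : K[X]}
    (h : φ ∈ tangentDirection μ ν) {ψ : K[X]} (hψ : ψ ∈ KP ν) : φ.natDegree ≤ ψ.natDegree := by
  by_contra! hlt
  obtain ⟨a, -, ha⟩ := exists_inverse hle h hψ.1.ne_zero (degree_lt_degree hlt)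
  exact not_muDvd_one hψ (muDvd_of_lt (q := a) (by rwa [AddValuation.map_one]))

theorem natDegree_tangentDirection_eq {μ ν η : Node v} (h₁ : μ < ν) (h₂ : ν < η) {φ φ' : K[X]}
    (h : φ ∈ tangentDirection μ ν) (h' : φ' ∈ tangentDirection μ η) :
    φ'.natDegree = φ.natDegree := by
  refine le_antisymm (h'.2.2 φ h.1 (h.2.1.trans_le (h₂.le φ))) ?_
  by_contra! hlt
  have h1 : ν φ' < η φ' :=
    (val_eq_of_degree_lt h₁.le h (degree_lt_degree hlt)) ▸ h'.2.1
  obtain ⟨ψ, hψ⟩ := tangentDirection_nonempty h₂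
  have h3 := natDegree_le_of_mem_KP h₁.le h (tangentDirection_subset_KP h₂ hψ)
  have h4 := hψ.2.2 φ' h'.1 h1
  omega

theorem degree_sub_lt_of_monic {φ φ' : K[X]} (h : φ.Monic) (h' : φ'.Monic)
    (hd : φ'.natDegree = φ.natDegree) : (φ' - φ).degree < φ.degree := by
  have hd' : φ'.degree = φ.degree := by
    rw [degree_eq_natDegree h.ne_zero, degree_eq_natDegree h'.ne_zero, hd]
  rw [← hd']
  exact degree_sub_lt_left hd' h'.ne_zero (by rw [h.leadingCoeff, h'.leadingCoeff])

/-- The tangent direction of `μ` does not change along a chain of larger nodes. -/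
theorem val_lt_of_mem_tangentDirection {μ ν η : Node v} (h₁ : μ < ν) (h₂ : ν < η) {φ : K[X]}
    (h : φ ∈ tangentDirection μ η) : μ φ < ν φ := by
  obtain ⟨φ', h'⟩ := tangentDirection_nonempty h₁
  have hd := natDegree_tangentDirection_eq h₁ h₂ h' h
  have ha := degree_sub_lt_of_monic h'.1 h.1 hd
  have hμν := val_eq_of_degree_lt h₁.le h' ha
  refine lt_of_le_of_ne (h₁.le φ) fun heq => ?_
  have hη : ν (φ - φ') = η (φ - φ') := by
    rw [← hμν]
    refine val_eq_of_degree_lt (h₁.trans h₂).le h (ha.trans_eq ?_)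
    rw [degree_eq_natDegree h'.1.ne_zero, degree_eq_natDegree h.1.ne_zero, hd]
  -- The difference has low degree, hence the same value at `μ`, `ν` and `η`; at `η` both `φ` and
  -- `φ'` exceed their values at `μ`.
  have h1 : μ φ < μ (φ - φ') ∨ μ φ' < μ (φ - φ') := by
    rw [hμν, hη]
    by_contra! hcon
    rcases le_total (μ φ) (μ φ') with hl | hl
    · refine absurd hcon.1 (not_le.2 ?_)
      rw [sub_eq_add_neg]
      refine AddValuation.map_lt_add _ h.2.1 ?_
      rw [AddValuation.map_neg]
      exact hl.trans_lt (h'.2.1.trans_le (h₂.le _))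
    · refine absurd hcon.2 (not_le.2 ?_)
      rw [sub_eq_add_neg]
      refine AddValuation.map_lt_add _ (hl.trans_lt h.2.1) ?_
      rw [AddValuation.map_neg]
      exact (h'.2.1.trans_le (h₂.le _))
  have h2 : μ φ = μ φ' := by
    rcases h1 with h1 | h1
    · refine (AddValuation.map_eq_of_lt_sub _ ?_).symm
      rwa [AddValuation.map_sub_swap]
    · exact AddValuation.map_eq_of_lt_sub _ h1
  have h3 : μ φ < ν (φ - φ') := by
    rw [← hμν]
    rcases h1 with h1 | h1
    · exact h1
    · rwa [h2]
  have h4 : μ φ < ν φ := by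
    have := AddValuation.map_lt_add ν.val h3 (h2 ▸ h'.2.1)
    rwa [sub_add_cancel] at this
  exact h4.ne heq

/-- A gain up to `η` means divisibility by a tangent direction that already gains at `ν`, so `f`
would gain at `ν` too. -/
theorem val_eq_of_val_eq {μ ν η : Node v} (h₁ : μ < ν) (h₂ : ν < η) {f : K[X]}
    (hf : μ f = ν f) : μ f = η f := by
  by_contra hne
  have hlt := lt_of_le_of_ne ((h₁.trans h₂).le f) hne
  obtain ⟨φ, h⟩ := tangentDirection_nonempty (h₁.trans h₂)
  have hdvd := muDvd_of_val_lt (h₁.trans h₂).le h hlt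
  exact (hdvd.val_lt h₁.le (val_lt_of_mem_tangentDirection h₁ h₂ h) hlt.ne_top).ne hf

/-! ### Construction of ordinary augmentations -/

/-- The map sending `∑ₛ aₛ φ^s` to the minimum of the `μ aₛ + s γ`, computed by successive
divisions by `φ`. -/
noncomputable def truncation (μ : Node v) (φ : K[X]) (γ : WithTop Λ) (f : K[X]) : WithTop Λ :=
  open Classical in
  if φ.Monic ∧ 1 ≤ φ.natDegree ∧ φ.natDegree ≤ f.natDegree then
    min (μ (f %ₘ φ)) (truncation μ φ γ (f /ₘ φ) + γ)
  else μ f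
termination_by f.natDegree
decreasing_by
  rename_i h
  rw [natDegree_divByMonic f h.1]
  omega

theorem adic_induction {φ : K[X]} (hφ : φ.Monic) (hd : 1 ≤ φ.natDegree) {P : K[X] → Prop}
    (zero : P 0) (step : ∀ r q : K[X], r.degree < φ.degree → P q → P (r + φ * q)) (f : K[X]) :
    P f := by
  induction hn : f.natDegree using Nat.strong_induction_on generalizing f with
  | _ n ih =>
  have hdiv := modByMonic_add_div f φ
  have hstep := step (f %ₘ φ) (f /ₘ φ) (degree_modByMonic_lt f hφ)
  rw [hdiv] at hstep
  refine hstep ?_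
  by_cases h : φ.natDegree ≤ f.natDegree
  · refine ih _ ?_ _ rfl
    rw [natDegree_divByMonic f hφ]
    omega
  · rw [(divByMonic_eq_zero_iff hφ).2 (degree_lt_degree (not_le.1 h))]
    exact zero

section

variable {μ ν : Node v} {φ : K[X]} {γ : WithTop Λ}

theorem truncation_of_degree_lt {f : K[X]} (h : f.natDegree < φ.natDegree) :
    truncation μ φ γ f = μ f := by
  rw [truncation, if_neg fun H => absurd H.2.2 (not_le.2 h)]

theorem truncation_add_mul (hφ : φ.Monic) (hd : 1 ≤ φ.natDegree) {r : K[X]} (q : K[X])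
    (hr : r.degree < φ.degree) :
    truncation μ φ γ (r + φ * q) = min (μ r) (truncation μ φ γ q + γ) := by
  obtain ⟨h1, h2⟩ := div_modByMonic_unique q r hφ ⟨rfl, hr⟩
  by_cases h : φ.natDegree ≤ (r + φ * q).natDegree
  · rw [truncation, if_pos ⟨hφ, hd, h⟩, h1, h2]
  · rw [truncation_of_degree_lt (not_le.1 h)]
    rw [(divByMonic_eq_zero_iff hφ).2 (degree_lt_degree (not_le.1 h))] at h1
    subst h1
    rw [truncation_of_degree_lt (by simpa using Nat.succ_le_iff.1 hd), AddValuation.map_zero, top_add, mul_zero,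
      add_zero, min_eq_left le_top]

theorem truncation_zero (hd : 1 ≤ φ.natDegree) : truncation μ φ γ 0 = ⊤ := by
  rw [truncation_of_degree_lt (by simpa using Nat.succ_le_iff.1 hd), AddValuation.map_zero]

theorem truncation_mul_self (hφ : φ.Monic) (hd : 1 ≤ φ.natDegree) (q : K[X]) :
    truncation μ φ γ (φ * q) = truncation μ φ γ q + γ := by
  have := truncation_add_mul (μ := μ) (γ := γ) hφ hd (r := 0) q
    (by rw [degree_zero]; exact bot_lt_iff_ne_bot.2 (degree_ne_bot.2 hφ.ne_zero))
  rwa [zero_add, AddValuation.map_zero, min_eq_right le_top] at this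

theorem truncation_pow_mul (hφ : φ.Monic) (hd : 1 ≤ φ.natDegree) (s : ℕ) (q : K[X]) :
    truncation μ φ γ (φ ^ s * q) = s • γ + truncation μ φ γ q := by
  induction s with
  | zero => simp
  | succ s ih =>
    rw [pow_succ', mul_assoc, truncation_mul_self hφ hd, ih, succ_nsmul, add_right_comm]

theorem min_le_truncation_add (hφ : φ.Monic) (hd : 1 ≤ φ.natDegree) (f g : K[X]) :
    min (truncation μ φ γ f) (truncation μ φ γ g) ≤ truncation μ φ γ (f + g) := by
  induction f using adic_induction hφ hd generalizing g with
  | zero => rw [zero_add]; exact min_le_right _ _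
  | step r q hr ih =>
    have hdiv := modByMonic_add_div g φ
    have hg := degree_modByMonic_lt g hφ
    rw [← hdiv, show r + φ * q + (g %ₘ φ + φ * (g /ₘ φ)) =
      (r + g %ₘ φ) + φ * (q + g /ₘ φ) by ring, truncation_add_mul hφ hd _ hr,
      truncation_add_mul hφ hd _ hg,
      truncation_add_mul hφ hd _ ((degree_add_le _ _).trans_lt (max_lt hr hg))]
    refine le_min ?_ ?_
    · exact (min_le_min (min_le_left _ _) (min_le_left _ _)).trans (AddValuation.map_add _ _ _)
    · refine (min_le_min (min_le_right _ _) (min_le_right _ _)).trans ?_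
      rw [min_add_add_right]
      exact add_le_add (ih _) le_rfl

theorem val_le_truncation (hle : μ ≤ ν) (h : φ ∈ tangentDirection μ ν) (hγ : μ φ ≤ γ)
    (f : K[X]) : μ f ≤ truncation μ φ γ f := by
  have hd := one_le_natDegree_of_mem_tangentDirection hle h
  induction f using adic_induction h.1 hd with
  | zero => rw [truncation_zero hd]; exact le_top
  | step r q hr ih =>
    rw [truncation_add_mul h.1 hd _ hr, val_add_mul hle h hr, add_comm (μ.val φ)]
    exact min_le_min le_rfl (add_le_add ih hγ)

/-- Multiplication of polynomials of small degree modulo a polynomial in a tangent direction. -/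
theorem exists_remainder (hlt : μ < ν) (h : φ ∈ tangentDirection μ ν) {a b : K[X]}
    (ha : a.degree < φ.degree) (hb : b.degree < φ.degree) :
    ∃ c d : K[X], c.degree < φ.degree ∧ a * b = c + φ * d ∧ μ c = μ a + μ b ∧
      μ a + μ b ≤ μ d + μ φ := by
  have hc := degree_modByMonic_lt (a * b) h.1
  have hdiv := modByMonic_add_div (a * b) φ
  have hmin := val_add_mul hlt.le h (q := (a * b) /ₘ φ) hc
  rw [hdiv] at hmin
  refine ⟨_, _, hc, hdiv.symm, ?_, ?_⟩
  · rw [← AddValuation.map_mul]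
    by_contra hne
    have hl : μ (a * b) < μ ((a * b) %ₘ φ) :=
      lt_of_le_of_ne (hmin.trans_le (min_le_left _ _)) (Ne.symm hne)
    -- Divisibility by `φ` would make `a * b` gain value at `ν`, but neither factor does.
    have hdvd : MuDvd μ φ (a * b) := by
      refine muDvd_of_lt (q := (a * b) /ₘ φ) (hl.trans_eq ?_)
      congr 1
      rw [eq_sub_iff_add_eq, hdiv]
    have h3 := hdvd.val_lt hlt.le h.2.1 hl.ne_top
    rw [AddValuation.map_mul, AddValuation.map_mul, val_eq_of_degree_lt hlt.le h ha,
      val_eq_of_degree_lt hlt.le h hb] at h3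
    exact lt_irrefl _ h3
  · rw [← AddValuation.map_mul, add_comm (μ.val _) (μ.val φ)]
    exact hmin.trans_le (min_le_right _ _)

/-- Multiplying a coefficient by `a` carries a quotient `d` into the next one; this costs nothing
since `μ d + γ ≥ μ d + μ φ`. -/
theorem add_truncation_le (hlt : μ < ν) (h : φ ∈ tangentDirection μ ν) (hγ : μ φ ≤ γ)
    {a : K[X]} (ha : a.degree < φ.degree) (g : K[X]) :
    μ a + truncation μ φ γ g ≤ truncation μ φ γ (a * g) := by
  have hd := one_le_natDegree_of_mem_tangentDirection hlt.le h
  induction g using adic_induction h.1 hd with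
  | zero => rw [mul_zero, truncation_zero hd]; exact le_top
  | step b q hb ih =>
    obtain ⟨c, d, hc, hab, hc', hd'⟩ := exists_remainder hlt h ha hb
    rw [mul_add, hab, show c + φ * d + a * (φ * q) = c + φ * (d + a * q) by ring,
      truncation_add_mul h.1 hd _ hb, truncation_add_mul h.1 hd _ hc, hc']
    refine le_min (add_le_add le_rfl (min_le_left _ _)) ?_
    refine le_trans ?_ (add_le_add (min_le_truncation_add h.1 hd _ _) le_rfl)
    rw [← min_add_add_right]
    refine le_min ?_ ?_
    · exact (add_le_add le_rfl (min_le_left _ _)).trans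
        (hd'.trans (add_le_add (val_le_truncation hlt.le h hγ d) hγ))
    · refine (add_le_add le_rfl (min_le_right _ _)).trans ?_
      rw [← add_assoc]
      exact add_le_add ih le_rfl

theorem truncation_neg_ge (hlt : μ < ν) (h : φ ∈ tangentDirection μ ν) (hγ : μ φ ≤ γ)
    (f : K[X]) : truncation μ φ γ f ≤ truncation μ φ γ (-f) := by
  have hd := one_le_natDegree_of_mem_tangentDirection hlt.le h
  have := add_truncation_le hlt h hγ (a := -1) (degree_lt_degree (by simpa using Nat.succ_le_iff.1 hd)) f
  rwa [AddValuation.map_neg, AddValuation.map_one, zero_add, neg_one_mul] at this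

theorem truncation_add_le_mul (hlt : μ < ν) (h : φ ∈ tangentDirection μ ν) (hγ : μ φ ≤ γ)
    (f g : K[X]) :
    truncation μ φ γ f + truncation μ φ γ g ≤ truncation μ φ γ (f * g) := by
  have hd := one_le_natDegree_of_mem_tangentDirection hlt.le h
  induction f using adic_induction h.1 hd with
  | zero => rw [zero_mul, truncation_zero hd]; exact le_top
  | step a q ha ih =>
    rw [add_mul, mul_assoc, truncation_add_mul h.1 hd _ ha]
    refine le_trans (le_min ?_ ?_) (min_le_truncation_add h.1 hd _ _)
    · exact (add_le_add (min_le_left _ _) le_rfl).trans (add_truncation_le hlt h hγ ha g)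
    · rw [truncation_mul_self h.1 hd]
      refine (add_le_add (min_le_right _ _) le_rfl).trans ?_
      rw [add_right_comm]
      exact add_le_add ih le_rfl

/-- `s` is the least exponent where the minimum is attained and `k` collects the lower terms. The
product of two such lowest monomials cannot be cancelled, whence multiplicativity. -/
theorem exists_leading_part (hlt : μ < ν) (h : φ ∈ tangentDirection μ ν)
    (f : K[X]) (hf : truncation μ φ γ f ≠ ⊤) :
    ∃ (s : ℕ) (a u k : K[X]), a.degree < φ.degree ∧ f = k + φ ^ s * (a + φ * u) ∧
      truncation μ φ γ f < truncation μ φ γ k ∧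
      truncation μ φ γ f = s • γ + μ a ∧
      truncation μ φ γ f ≤ truncation μ φ γ (φ ^ s * (a + φ * u)) := by
  have hd := one_le_natDegree_of_mem_tangentDirection hlt.le h
  induction f using adic_induction h.1 hd with
  | zero => exact absurd (truncation_zero hd) hf
  | step r q hr ih =>
    have hT := truncation_add_mul (μ := μ) (γ := γ) h.1 hd q hr
    rcases le_or_gt (μ r) (truncation μ φ γ q + γ) with hl | hl
    · rw [min_eq_left hl] at hT
      refine ⟨0, r, q, 0, hr, by ring, ?_, by rw [hT, zero_smul, zero_add], by simp⟩
      rw [truncation_zero hd]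
      exact lt_top_iff_ne_top.2 hf
    · rw [min_eq_right hl.le] at hT
      rw [hT] at hf ⊢
      rw [WithTop.add_ne_top] at hf
      obtain ⟨s, a, u, k, ha, hq, h1, h2, h3⟩ := ih hf.1
      refine ⟨s + 1, a, u, r + φ * k, ha, ?_, ?_, ?_, ?_⟩
      · nth_rewrite 1 [hq]; ring
      · rw [truncation_add_mul h.1 hd _ hr]
        refine lt_min hl ?_
        rw [add_comm, add_comm _ γ]
        exact add_lt_add_of_ne_top hf.2 le_rfl h1
      · rw [h2, succ_nsmul, add_right_comm]
      · rw [pow_succ', mul_assoc, truncation_mul_self h.1 hd]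
        exact add_le_add h3 le_rfl

theorem truncation_mul (hlt : μ < ν) (h : φ ∈ tangentDirection μ ν) (hγ : μ φ ≤ γ)
    (f g : K[X]) :
    truncation μ φ γ (f * g) = truncation μ φ γ f + truncation μ φ γ g := by
  have hd := one_le_natDegree_of_mem_tangentDirection hlt.le h
  have hge := truncation_add_le_mul hlt h hγ
  refine le_antisymm ?_ (hge f g)
  by_cases hf : truncation μ φ γ f = ⊤
  · rw [hf, top_add]; exact le_top
  by_cases hg : truncation μ φ γ g = ⊤
  · rw [hg, add_top]; exact le_top
  obtain ⟨s, a, u, k, ha, hf1, hf2, hf3, hf4⟩ := exists_leading_part hlt h f hf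
  obtain ⟨t, b, y, l, hb, hg1, hg2, hg3, hg4⟩ := exists_leading_part hlt h g hg
  set F := φ ^ s * (a + φ * u) with hF
  set G := φ ^ t * (b + φ * y) with hG
  obtain ⟨c, d, hc, hab, hc', -⟩ := exists_remainder hlt h ha hb
  -- The coefficient of `φ ^ (s + t)` in `F * G` is the remainder `c` of `a * b`, of value `μ a + μ
  -- b`.
  have hFG : truncation μ φ γ (F * G) ≤ truncation μ φ γ f + truncation μ φ γ g := by
    have : F * G = φ ^ (s + t) * (c + φ * (d + a * y + u * b + φ * u * y)) := by
      have : F * G = φ ^ (s + t) * (a * b + φ * (a * y + u * b + φ * u * y)) := by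
        rw [hF, hG]; ring
      rw [this, hab]; ring
    rw [this, truncation_pow_mul h.1 hd, truncation_add_mul h.1 hd _ hc, hc', hf3, hg3]
    refine (add_le_add le_rfl (min_le_left _ _)).trans_eq ?_
    rw [add_nsmul, add_add_add_comm]
  have hJ : truncation μ φ γ f + truncation μ φ γ g < truncation μ φ γ (k * g + F * l) := by
    refine lt_of_lt_of_le (lt_min ?_ ?_) (min_le_truncation_add h.1 hd _ _)
    · refine lt_of_lt_of_le ?_ (hge _ _)
      rw [add_comm, add_comm (truncation μ φ γ k)]
      exact add_lt_add_of_ne_top hg le_rfl hf2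
    · exact lt_of_lt_of_le (add_lt_add_of_ne_top hf hf4 hg2) (hge _ _)
  by_contra! hcon
  refine absurd hFG (not_le.2 ?_)
  have : F * G = f * g + -(k * g + F * l) := by
    have h1 : f * g = (k + F) * g := by rw [← hf1]
    have h2 : F * g = F * (l + G) := by rw [← hg1]
    rw [h1, add_mul, h2]; ring
  rw [this]
  exact lt_of_lt_of_le (lt_min hcon (hJ.trans_le (truncation_neg_ge hlt h hγ _)))
    (min_le_truncation_add h.1 hd _ _)

/-- The ordinary augmentation `[μ; φ, γ]`. -/
noncomputable def augmentation (hlt : μ < ν) (h : φ ∈ tangentDirection μ ν) (hγ : μ φ ≤ γ) :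
    Node v where
  val := AddValuation.of (truncation μ φ γ)
    (truncation_zero (one_le_natDegree_of_mem_tangentDirection hlt.le h))
    (by
      have hd := one_le_natDegree_of_mem_tangentDirection hlt.le h
      rw [truncation_of_degree_lt (by simpa using Nat.succ_le_iff.1 hd), AddValuation.map_one])
    (min_le_truncation_add h.1 (one_le_natDegree_of_mem_tangentDirection hlt.le h))
    (truncation_mul hlt h hγ)
  val_C a := by
    have hd := one_le_natDegree_of_mem_tangentDirection hlt.le h
    rw [AddValuation.of_apply, truncation_of_degree_lt (by simpa using Nat.succ_le_iff.1 hd), μ.val_C]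

end

/-! ### Nodes given by truncation -/

/-- `η` sends `∑ₛ aₛ φ^s`, with `deg aₛ < deg φ`, to the minimum of the `μ aₛ + s γ`. -/
structure IsTruncation (μ : Node v) (φ : K[X]) (γ : WithTop Λ) (η : Node v) : Prop where
  monic : φ.Monic
  one_le : 1 ≤ φ.natDegree
  add_mul : ∀ r q : K[X], r.degree < φ.degree → η (r + φ * q) = min (μ r) (η q + γ)

theorem isTruncation_augmentation {μ ν : Node v} {φ : K[X]} {γ : WithTop Λ} (hlt : μ < ν)
    (h : φ ∈ tangentDirection μ ν) (hγ : μ φ ≤ γ) :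
    IsTruncation μ φ γ (augmentation hlt h hγ) :=
  ⟨h.1, one_le_natDegree_of_mem_tangentDirection hlt.le h, fun _ q hr =>
    truncation_add_mul h.1 (one_le_natDegree_of_mem_tangentDirection hlt.le h) q hr⟩

theorem isTruncation_self {μ ν : Node v} {φ : K[X]} (hle : μ ≤ ν)
    (h : φ ∈ tangentDirection μ ν) : IsTruncation μ φ (μ φ) μ :=
  ⟨h.1, one_le_natDegree_of_mem_tangentDirection hle h, fun r q hr => by
    rw [val_add_mul hle h hr, add_comm]⟩

namespace IsTruncation

variable {μ η : Node v} {φ : K[X]} {γ : WithTop Λ}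

theorem val_eq (h : IsTruncation μ φ γ η) {r : K[X]} (hr : r.degree < φ.degree) :
    η r = μ r := by
  have := h.add_mul r 0 hr
  rwa [mul_zero, add_zero, AddValuation.map_zero, top_add, min_eq_left le_top] at this

theorem val_self (h : IsTruncation μ φ γ η) : η φ = γ := by
  have := h.add_mul 0 1 (by
    rw [degree_zero]; exact bot_lt_iff_ne_bot.2 (degree_ne_bot.2 h.monic.ne_zero))
  rwa [mul_one, zero_add, AddValuation.map_zero, AddValuation.map_one, zero_add,
    min_eq_right le_top] at this

theorem congr (h : IsTruncation μ φ γ η) {μ' : Node v}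
    (hμ : ∀ r : K[X], r.degree < φ.degree → μ r = μ' r) : IsTruncation μ' φ γ η :=
  ⟨h.monic, h.one_le, fun r q hr => by rw [h.add_mul r q hr, hμ r hr]⟩

/-- A truncation is minimal for its values in low degree and at `φ`, so comparing nodes reduces to
these data. -/
theorem le_of_le (h : IsTruncation μ φ γ η) {θ : Node v}
    (hθ : ∀ r : K[X], r.degree < φ.degree → μ r ≤ θ r) (hφ : γ ≤ θ φ) : η ≤ θ := by
  intro f
  induction f using adic_induction h.monic h.one_le with
  | zero => rw [AddValuation.map_zero θ.val]; exact le_top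
  | step r q hr ih =>
    rw [h.add_mul r q hr]
    refine le_trans (min_le_min (hθ r hr) ?_) (AddValuation.map_add _ _ _)
    rw [AddValuation.map_mul, add_comm]
    exact add_le_add hφ ih

/-- The value of a monic polynomial of the degree of `φ`. -/
theorem val_of_natDegree_eq (h : IsTruncation μ φ γ η) {ψ : K[X]} (hψ : ψ.Monic)
    (hd : ψ.natDegree = φ.natDegree) : η ψ = min (μ (ψ - φ)) γ := by
  have := h.add_mul (ψ - φ) 1 (degree_sub_lt_of_monic h.monic hψ hd)
  rwa [mul_one, sub_add_cancel, AddValuation.map_one, zero_add] at this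

theorem val_sum (h : IsTruncation μ φ γ η) (N : ℕ) (p : ℕ → K[X])
    (hp : ∀ s, (p s).degree < φ.degree) :
    η (∑ s ∈ Finset.range N, p s * φ ^ s) = (Finset.range N).inf fun s => μ (p s) + s • γ := by
  induction N generalizing p with
  | zero => rw [Finset.range_zero, Finset.sum_empty, Finset.inf_empty, AddValuation.map_zero]
  | succ N ih =>
    rw [Finset.sum_range_succ']
    have h1 : ∑ s ∈ Finset.range N, p (s + 1) * φ ^ (s + 1) =
        φ * ∑ s ∈ Finset.range N, p (s + 1) * φ ^ s := by
      rw [Finset.mul_sum]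
      exact Finset.sum_congr rfl fun s _ => by ring
    rw [h1, pow_zero, mul_one, add_comm, h.add_mul _ _ (hp 0), ih (fun s => p (s + 1))
      fun s => hp _, Finset.range_add_one', Finset.inf_insert, Finset.inf_map, zero_smul, add_zero]
    change _ ⊓ _ = _ ⊓ _
    congr 1
    have : ∀ x : WithTop Λ, ∀ t : Finset ℕ, ∀ g : ℕ → WithTop Λ,
        t.inf g + x = if t.Nonempty then t.inf (fun s => g s + x) else ⊤ := by
      intro x t g
      induction t using Finset.induction_on with
      | empty => simp
      | insert a t ha ih =>
        rw [if_pos (Finset.insert_nonempty _ _), Finset.inf_insert, Finset.inf_insert]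
        rw [← min_add_add_right, ih]
        split_ifs with ht
        · rfl
        · rw [Finset.not_nonempty_iff_eq_empty.1 ht, Finset.inf_empty]
    rw [this]
    split_ifs with ht
    · refine Finset.inf_congr rfl fun s _ => ?_
      change _ = μ (p (s + 1)) + (s + 1) • γ
      rw [succ_nsmul, add_assoc]
    · rw [Finset.not_nonempty_iff_eq_empty.1 ht, Finset.inf_empty]

theorem isAugmentation (h : IsTruncation μ φ γ η) (hφ : φ ∈ KP μ) (hγ : μ φ < γ) :
    IsAugmentation μ φ γ η := by
  classical
  refine ⟨hφ, hγ, fun a ha => ?_⟩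
  obtain ⟨N, hN⟩ := a.support.exists_nat_subset_range
  rw [Finsupp.sum_of_support_subset a hN _ (by simp), h.val_sum N a ha]
  refine le_antisymm (Finset.inf_mono hN) ?_
  refine Finset.le_inf fun s _ => ?_
  by_cases hs : s ∈ a.support
  · exact Finset.inf_le hs
  · rw [Finsupp.notMem_support_iff.1 hs, AddValuation.map_zero, top_add]
    exact le_top

end IsTruncation

theorem mem_tangentDirection_of {μ ν : Node v} {φ : K[X]} (hφ : φ.Monic) (hlt : μ φ < ν φ)
    (h : ∀ r : K[X], r.degree < φ.degree → μ r = ν r) : φ ∈ tangentDirection μ ν := by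
  refine ⟨hφ, hlt, fun ψ _ hψ => ?_⟩
  by_contra! hcon
  exact hψ.ne (h ψ (degree_lt_degree hcon))

/-! ### Chains of truncations with a common degree -/

/-- A set `X` of monic polynomials of degree `m`, with values `γ χ`, such that the truncations
`ζ χ` of a common node form a chain without a maximal element. -/
structure IsTruncationSystem (w : Node v) (m : ℕ) (X : Set K[X]) (γ : K[X] → Λ)
    (ζ : K[X] → Node v) : Prop where
  natDegree_eq : ∀ χ ∈ X, χ.natDegree = m
  isTruncation : ∀ χ ∈ X, IsTruncation w χ (γ χ) (ζ χ)
  exists_below : ∀ χ ∈ X, ∃ μ : Node v, μ < ζ χ ∧ χ ∈ tangentDirection μ (ζ χ)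
  exists_above : ∀ χ ∈ X, ∃ η : Node v, ζ χ < η ∧ χ ∈ tangentDirection (ζ χ) η
  val_sub : ∀ χ ∈ X, ∀ χ' ∈ X, γ χ < γ χ' → w (χ' - χ) = γ χ
  no_max : ∀ χ ∈ X, ∃ χ' ∈ X, γ χ < γ χ'

namespace IsTruncationSystem

variable {w : Node v} {m : ℕ} {X : Set K[X]} {γ : K[X] → Λ} {ζ : K[X] → Node v}

theorem degree_eq (S : IsTruncationSystem w m X γ ζ) {χ : K[X]} (h : χ ∈ X) : χ.degree = m := by
  rw [degree_eq_natDegree (S.isTruncation χ h).monic.ne_zero, S.natDegree_eq χ h]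

theorem val_eq (S : IsTruncationSystem w m X γ ζ) {χ : K[X]} (h : χ ∈ X) {r : K[X]}
    (hr : r.degree < m) : ζ χ r = w r :=
  (S.isTruncation χ h).val_eq (hr.trans_eq (S.degree_eq h).symm)

theorem val_of_lt (S : IsTruncationSystem w m X γ ζ) {χ χ' : K[X]} (h : χ ∈ X) (h' : χ' ∈ X)
    (hlt : γ χ < γ χ') : ζ χ χ' = γ χ := by
  rw [(S.isTruncation χ h).val_of_natDegree_eq (S.isTruncation χ' h').monic
    (by rw [S.natDegree_eq χ h, S.natDegree_eq χ' h']), S.val_sub χ h χ' h' hlt, min_self]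

theorem lt_of_lt (S : IsTruncationSystem w m X γ ζ) {χ χ' : K[X]} (h : χ ∈ X) (h' : χ' ∈ X)
    (hlt : γ χ < γ χ') : ζ χ < ζ χ' := by
  refine lt_of_le_of_ne ((S.isTruncation χ h).le_of_le (fun r hr => ?_) ?_) fun heq => ?_
  · exact (S.val_eq h' (hr.trans_eq (S.degree_eq h))).ge
  · rw [(S.isTruncation χ' h').val_of_natDegree_eq (S.isTruncation χ h).monic
      (by rw [S.natDegree_eq χ h, S.natDegree_eq χ' h']), AddValuation.map_sub_swap,
      S.val_sub χ h χ' h' hlt]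
    exact le_min le_rfl (WithTop.coe_le_coe.2 hlt.le)
  · have h1 := S.val_of_lt h h' hlt
    rw [heq, (S.isTruncation χ' h').val_self] at h1
    exact hlt.ne' (WithTop.coe_injective h1)

theorem mem_tangentDirection (S : IsTruncationSystem w m X γ ζ) {χ χ' : K[X]} (h : χ ∈ X)
    (h' : χ' ∈ X) (hlt : γ χ < γ χ') : χ' ∈ tangentDirection (ζ χ) (ζ χ') := by
  refine mem_tangentDirection_of (S.isTruncation χ' h').monic ?_ fun r hr => ?_
  · rw [S.val_of_lt h h' hlt, (S.isTruncation χ' h').val_self]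
    exact WithTop.coe_lt_coe.2 hlt
  · rw [S.degree_eq h'] at hr
    rw [S.val_eq h hr, S.val_eq h' hr]

theorem mem_KP (S : IsTruncationSystem w m X γ ζ) {χ : K[X]} (h : χ ∈ X) : χ ∈ KP (ζ χ) := by
  obtain ⟨η, hη, ht⟩ := S.exists_above χ h
  exact tangentDirection_subset_KP hη ht

theorem le_natDegree (S : IsTruncationSystem w m X γ ζ) {χ ψ : K[X]} (h : χ ∈ X)
    (hψ : ψ ∈ KP (ζ χ)) : m ≤ ψ.natDegree := by
  obtain ⟨μ, hμ, ht⟩ := S.exists_below χ h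
  rw [← S.natDegree_eq χ h]
  exact natDegree_le_of_mem_KP hμ.le ht hψ

theorem mem_minKP (S : IsTruncationSystem w m X γ ζ) {χ : K[X]} (h : χ ∈ X) :
    χ ∈ minKP (ζ χ) :=
  ⟨S.mem_KP h, fun _ hψ => (S.natDegree_eq χ h).trans_le (S.le_natDegree h hψ)⟩

theorem deg_eq (S : IsTruncationSystem w m X γ ζ) {χ : K[X]} (h : χ ∈ X) : deg (ζ χ) = m := by
  have hmem : m ∈ Polynomial.natDegree '' KP (ζ χ) := ⟨χ, S.mem_KP h, S.natDegree_eq χ h⟩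
  refine le_antisymm (Nat.sInf_le hmem) ?_
  obtain ⟨ψ, hψ, hd⟩ := Nat.sInf_mem ⟨m, hmem⟩
  rw [deg, ← hd]
  exact S.le_natDegree h hψ

theorem sv_eq (S : IsTruncationSystem w m X γ ζ) {χ : K[X]} (h : χ ∈ X) : sv (ζ χ) = γ χ := by
  have hne : (minKP (ζ χ)).Nonempty := ⟨χ, S.mem_minKP h⟩
  rw [sv, dif_pos hne]
  obtain ⟨hK, hmin⟩ := hne.some_mem
  set ψ := hne.some
  have hd : ψ.natDegree = χ.natDegree :=
    le_antisymm (hmin χ (S.mem_KP h)) ((S.mem_minKP h).2 ψ hK)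
  have hdeg := degree_sub_lt_of_monic (S.isTruncation χ h).monic hK.1 hd
  have hval := (S.isTruncation χ h).val_of_natDegree_eq hK.1 hd
  rw [hval]
  refine min_eq_right ?_
  by_contra! hlt
  rw [min_eq_left hlt.le] at hval
  have h0 : ψ - χ ≠ 0 := by
    intro h0
    rw [h0, AddValuation.map_zero] at hlt
    exact not_top_lt hlt
  -- If `ψ - χ` had value below `γ χ`, it would be equivalent to `ψ`, against the minimality of `ψ`.
  refine hK.2.1 (ψ - χ) h0 (hdeg.trans_eq ?_) ?_
  · rw [degree_eq_natDegree (S.isTruncation χ h).monic.ne_zero, degree_eq_natDegree hK.1.ne_zero,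
      hd]
  · refine muDvd_of_lt (q := 1) ?_
    rw [mul_one, sub_sub_cancel_left, AddValuation.map_neg, (S.isTruncation χ h).val_self,
      (S.isTruncation χ h).val_eq hdeg]
    exact hlt

theorem isInner (S : IsTruncationSystem w m X γ ζ) {χ : K[X]} (h : χ ∈ X) : IsInner (ζ χ) := by
  obtain ⟨η, hη, -⟩ := S.exists_above χ h
  exact fun hmax => hmax.not_lt hη

/-- The values of the polynomials of degree smaller than `m` form a group. -/
theorem exists_val_of_mem_closure (S : IsTruncationSystem w m X γ ζ) {χ : K[X]} (h : χ ∈ X)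
    {g : Λ}
    (hg : g ∈ AddSubgroup.closure {g : Λ | ∃ a : K[X], a ≠ 0 ∧ a.degree < m ∧ w a = g}) :
    ∃ a : K[X], a ≠ 0 ∧ a.degree < m ∧ w a = g := by
  obtain ⟨μ, hμ, ht⟩ := S.exists_below χ h
  have hdeg := S.degree_eq h
  have hμw : ∀ r : K[X], r.degree < m → μ r = w r := fun r hr => by
    rw [val_eq_of_degree_lt hμ.le ht (hr.trans_eq hdeg.symm), S.val_eq h hr]
  have hne : ∀ (a : K[X]) (g : Λ), w a = g → a ≠ 0 := by
    rintro a g ha rfl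
    rw [AddValuation.map_zero] at ha
    exact WithTop.coe_ne_top ha.symm
  induction hg using AddSubgroup.closure_induction with
  | mem g hg => exact hg
  | zero =>
    have hm := (S.isTruncation χ h).one_le
    rw [S.natDegree_eq χ h] at hm
    refine ⟨1, one_ne_zero, ?_, by rw [AddValuation.map_one]; rfl⟩
    rw [degree_one]
    exact_mod_cast hm
  | add g g' _ _ ih ih' =>
    obtain ⟨a, -, ha, hag⟩ := ih
    obtain ⟨b, -, hb, hbg⟩ := ih'
    obtain ⟨c, d, hc, -, hc', -⟩ := exists_remainder hμ ht (ha.trans_eq hdeg.symm)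
      (hb.trans_eq hdeg.symm)
    rw [hdeg] at hc
    rw [hμw _ ha, hμw _ hb, hμw _ hc, hag, hbg, ← WithTop.coe_add] at hc'
    exact ⟨c, hne c _ hc', hc, hc'⟩
  | neg g _ ih =>
    obtain ⟨a, ha0, ha, hag⟩ := ih
    obtain ⟨b, hb, hlt⟩ := exists_inverse hμ.le ht ha0 (ha.trans_eq hdeg.symm)
    rw [hdeg] at hb
    have h1 : ζ χ (a * b) = 0 := by
      rw [← AddValuation.map_one (ζ χ).val]
      refine AddValuation.map_eq_of_lt_sub _ ?_
      rwa [AddValuation.map_one, AddValuation.map_sub_swap]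
    rw [AddValuation.map_mul, S.val_eq h ha, S.val_eq h hb, hag] at h1
    have hbt : w b ≠ ⊤ := by
      intro hbt
      rw [hbt, add_top] at h1
      exact WithTop.top_ne_zero h1
    obtain ⟨g', hg'⟩ := WithTop.ne_top_iff_exists.1 hbt
    rw [← hg', ← WithTop.coe_add, ← WithTop.coe_zero, WithTop.coe_eq_coe] at h1
    rw [eq_neg_of_add_eq_zero_right h1] at hg'
    exact ⟨b, hne b _ hg'.symm, hb, hg'.symm⟩

theorem valueGroupZero_eq (S : IsTruncationSystem w m X γ ζ) {χ : K[X]} (h : χ ∈ X) :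
    valueGroupZero (ζ χ) =
      AddSubgroup.closure {g : Λ | ∃ a : K[X], a ≠ 0 ∧ a.degree < m ∧ w a = g} := by
  rw [valueGroupZero, S.deg_eq h]
  congr 1
  ext g
  refine exists_congr fun a => and_congr_right fun ha => ?_
  rw [natDegree_lt_iff_degree_lt ha]
  exact and_congr_right fun hd => by rw [S.val_eq h hd]

/-- The absence of a maximum supplies a later `χ'`, and `χ' - χ` has value `γ χ`. This is what makes
the relative ramification index one. -/
theorem exists_val_eq_sv (S : IsTruncationSystem w m X γ ζ) {χ : K[X]} (h : χ ∈ X) :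
    ∃ a : K[X], a ≠ 0 ∧ a.degree < m ∧ w a = γ χ := by
  obtain ⟨χ', h', hlt⟩ := S.no_max χ h
  have hv := S.val_sub χ h χ' h' hlt
  refine ⟨χ' - χ, fun h0 => ?_, ?_, hv⟩
  · rw [h0, AddValuation.map_zero] at hv
    exact WithTop.coe_ne_top hv.symm
  · rw [← S.degree_eq h]
    exact degree_sub_lt_of_monic (S.isTruncation χ h).monic (S.isTruncation χ' h').monic
      (by rw [S.natDegree_eq χ h, S.natDegree_eq χ' h'])

theorem valueGroup_le (S : IsTruncationSystem w m X γ ζ) {χ : K[X]} (h : χ ∈ X) :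
    valueGroup (ζ χ) ≤ valueGroupZero (ζ χ) := by
  rw [S.valueGroupZero_eq h, valueGroup, AddSubgroup.closure_le]
  rintro g ⟨f, hf⟩
  have hT := S.isTruncation χ h
  induction f using adic_induction hT.monic hT.one_le generalizing g with
  | zero =>
    rw [AddValuation.map_zero] at hf
    exact absurd hf.symm WithTop.coe_ne_top
  | step r q hr ih =>
    rw [hT.add_mul r q hr] at hf
    rw [S.degree_eq h] at hr
    rcases min_choice (w r) (ζ χ q + γ χ) with hm | hm
    · rw [hm] at hf
      refine AddSubgroup.subset_closure ⟨r, ?_, hr, hf⟩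
      rintro rfl
      rw [AddValuation.map_zero] at hf
      exact WithTop.coe_ne_top hf.symm
    · rw [hm] at hf
      have hq : ζ χ q ≠ ⊤ := by
        intro hq
        rw [hq, top_add] at hf
        exact WithTop.coe_ne_top hf.symm
      obtain ⟨g', hg'⟩ := WithTop.ne_top_iff_exists.1 hq
      rw [← hg', ← WithTop.coe_add, WithTop.coe_eq_coe] at hf
      rw [← hf]
      exact AddSubgroup.add_mem _ (ih hg'.symm)
        (AddSubgroup.subset_closure (S.exists_val_eq_sv h))

theorem mem_valueGroup_iff (S : IsTruncationSystem w m X γ ζ) {χ : K[X]} (h : χ ∈ X) {g : Λ} :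
    g ∈ valueGroup (ζ χ) ↔ ∃ a : K[X], a ≠ 0 ∧ a.degree < m ∧ w a = g := by
  constructor
  · intro hg
    have := S.valueGroup_le h hg
    rw [S.valueGroupZero_eq h] at this
    exact S.exists_val_of_mem_closure h this
  · rintro ⟨a, -, ha, hag⟩
    exact AddSubgroup.subset_closure ⟨a, by rw [S.val_eq h ha, hag]⟩

theorem not_muEquiv (S : IsTruncationSystem w m X γ ζ) {χ χ' : K[X]} (h : χ ∈ X) (h' : χ' ∈ X)
    (hlt : γ χ < γ χ') : ¬ MuEquiv (ζ χ) χ χ' := by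
  intro heq
  have hT := S.isTruncation χ h
  have h1 := lt_sub_of_muEquiv heq (by rw [hT.val_self]; exact WithTop.coe_ne_top)
  have hd := degree_sub_lt_of_monic hT.monic (S.isTruncation χ' h').monic
    (by rw [S.natDegree_eq χ h, S.natDegree_eq χ' h'])
  rw [AddValuation.map_sub_swap, hT.val_self, hT.val_eq hd, S.val_sub χ h χ' h' hlt] at h1
  exact lt_irrefl _ h1

theorem isAugmentation (S : IsTruncationSystem w m X γ ζ) {χ χ' : K[X]} (h : χ ∈ X)
    (h' : χ' ∈ X) (hlt : γ χ < γ χ') : IsAugmentation (ζ χ) χ' (sv (ζ χ')) (ζ χ') := by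
  -- The base `w` may be replaced by `ζ χ`, since they agree in degree `< m`.
  have hT := (S.isTruncation χ' h').congr (μ' := ζ χ) fun r hr =>
    (S.val_eq h (hr.trans_eq (S.degree_eq h'))).symm
  rw [S.sv_eq h']
  refine hT.isAugmentation
    (tangentDirection_subset_KP (S.lt_of_lt h h' hlt) (S.mem_tangentDirection h h' hlt)) ?_
  rw [S.val_of_lt h h' hlt]
  exact WithTop.coe_lt_coe.2 hlt

end IsTruncationSystem

/-- Well-order `α` arbitrarily and keep the elements larger than all their predecessors; on these
the two orders agree. -/
theorem exists_wellFoundedLT_isCofinal (α : Type*) [LinearOrder α] :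
    ∃ s : Set α, IsCofinal s ∧ WellFoundedLT s := by
  refine ⟨_, isCofinal_setOfPred_imp_lt (WellOrderingRel : α → α → Prop), ⟨?_⟩⟩
  refine Subrelation.wf (r := fun a b => WellOrderingRel a.1 b.1) ?_
    (InvImage.wf Subtype.val (IsWellFounded.wf (r := (WellOrderingRel : α → α → Prop))))
  intro a b hab
  rcases trichotomous_of WellOrderingRel a.1 b.1 with h | h | h
  · exact h
  · exact absurd (Subtype.ext h) hab.ne
  · exact absurd (a.2 b.1 h) (not_lt.2 (le_of_lt hab))

/-! ### From a continuous family to a chain of truncations -/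

section Families

variable {ι : Type*} [LinearOrder ι] {ρ : ι → Node v} {m : ℕ}

theorem natDegree_eq_of_stable {i₀ : ι} (hfam : IsTotallyOrderedFamily ρ)
    (hi₀ : ∀ i, i₀ ≤ i → deg (ρ i) = m) {i j : ι} (hi : i₀ ≤ i) (hij : i < j) {φ : K[X]}
    (h : φ ∈ tangentDirection (ρ i) (ρ j)) : φ.natDegree = m := by
  have hlt := hfam.strictMono hij
  refine le_antisymm ?_ ?_
  -- A node above `ρ j` ensures that `ρ j` has key polynomials, so that the infimum defining `deg`
  -- is attained.
  · obtain ⟨k, hk⟩ := hfam.no_max j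
    obtain ⟨ψ, hψ⟩ := tangentDirection_nonempty (hfam.strictMono hk)
    have hne : (Polynomial.natDegree '' KP (ρ j)).Nonempty :=
      ⟨_, ψ, tangentDirection_subset_KP (hfam.strictMono hk) hψ, rfl⟩
    obtain ⟨χ, hχ, hd⟩ := Nat.sInf_mem hne
    rw [← hi₀ j (hi.trans hij.le), deg, ← hd]
    exact natDegree_le_of_mem_KP hlt.le h hχ
  · rw [← hi₀ i hi]
    exact Nat.sInf_le ⟨φ, tangentDirection_subset_KP hlt h, rfl⟩

/-- Without divisibility by the tangent direction the value is stationary for one step, hence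
forever by `val_eq_of_val_eq`. -/
theorem exists_eventually_val_eq (hfam : IsTotallyOrderedFamily ρ) {f : K[X]}
    (hf : IsStable ρ f) : ∃ k, ∀ l, k ≤ l → ρ l f = ρ k f := by
  obtain ⟨-, i, φ, hφ, hdvd⟩ := hf
  simp only [familyTangentDirection, Set.mem_iUnion] at hφ
  obtain ⟨j, hij, h⟩ := hφ
  have hlt := hfam.strictMono hij
  have heq : ρ i f = ρ j f := by
    by_contra hne
    exact hdvd (muDvd_of_val_lt hlt.le h (lt_of_le_of_ne (hlt.le f) hne))
  refine ⟨j, fun l hl => ?_⟩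
  rcases hl.eq_or_lt with rfl | hl
  · rfl
  · rw [← heq, val_eq_of_val_eq hlt (hfam.strictMono hl) heq]

theorem isStable_of_lt_unstableDegree (hm : (m : ℕ∞) < unstableDegree ρ) {f : K[X]}
    (hf : f.Monic) (hd : f.natDegree = m) : IsStable ρ f := by
  classical
  by_contra hcon
  have hex : ∃ n, ∃ ψ : K[X], ψ.Monic ∧ ¬ IsStable ρ ψ ∧ ψ.natDegree = n := ⟨_, f, hf, hcon, rfl⟩
  obtain ⟨ψ, h1, h2, h3⟩ := Nat.find_spec hex
  have hψ : ψ ∈ KPinf ρ := ⟨h1, h2, fun χ hχ hχ' => h3 ▸ Nat.find_min' hex ⟨χ, hχ, hχ', rfl⟩⟩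
  have hle : unstableDegree ρ ≤ ψ.natDegree := iInf₂_le ψ hψ
  have := hψ.2.2 f hf hcon
  rw [hd] at this
  exact absurd (hle.trans (Nat.cast_le.2 this)) (not_le.2 hm)

/-- The truncations of a continuous family at its polynomials of stable degree. -/
theorem exists_isTruncationSystem (hρ : IsContinuousFamily ρ m)
    (hm : (m : ℕ∞) < unstableDegree ρ) :
    ∃ (w : Node v) (X : Set K[X]) (γ : K[X] → Λ) (ζ : K[X] → Node v),
      IsTruncationSystem w m X γ ζ ∧ X.Nonempty ∧ (∀ i, ∃ χ ∈ X, ρ i ≤ ζ χ) ∧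
        ∀ χ ∈ X, ∃ i, ζ χ ≤ ρ i := by
  obtain ⟨hfam, i₀, hi₀⟩ := hρ
  have hmono := hfam.strictMono.monotone
  have htan : ∀ {i j : ι}, i₀ ≤ i → i < j → ∀ {φ : K[X]}, φ ∈ tangentDirection (ρ i) (ρ j) →
      φ.natDegree = m := fun hi hij _ h => natDegree_eq_of_stable hfam hi₀ hi hij h
  have hagree : ∀ i, i₀ ≤ i → ∀ r : K[X], r.degree < m → ρ i r = ρ i₀ r := by
    intro i hi r hr
    rcases hi.eq_or_lt with rfl | hi
    · rfl
    · obtain ⟨φ, h⟩ := tangentDirection_nonempty (hfam.strictMono hi)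
      refine (val_eq_of_degree_lt (hmono hi.le) h (hr.trans_eq ?_)).symm
      rw [degree_eq_natDegree h.1.ne_zero, htan le_rfl hi h]
  have hst : ∀ χ : K[X], χ.Monic → χ.natDegree = m →
      ∃ (g : Λ) (k : ι), i₀ ≤ k ∧ ∀ l, k ≤ l → ρ l χ = g := by
    intro χ hχ hd
    obtain ⟨k, hk⟩ := exists_eventually_val_eq hfam (isStable_of_lt_unstableDegree hm hχ hd)
    obtain ⟨l, hl⟩ := hfam.no_max (max k i₀)
    obtain ⟨g, hg⟩ := WithTop.ne_top_iff_exists.1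
      (val_ne_top_of_lt (hfam.strictMono hl) hχ.ne_zero)
    refine ⟨g, max k i₀, le_max_right _ _, fun l hl => ?_⟩
    rw [hk l ((le_max_left _ _).trans hl), hg, hk _ (le_max_left _ _)]
  have : Nonempty ι := ⟨i₀⟩
  choose! γ k hk hγ using hst
  have hγle : ∀ χ : K[X], χ.Monic → χ.natDegree = m → ∀ i, ρ i χ ≤ γ χ := by
    intro χ hχ hd i
    rw [← hγ χ hχ hd (max i (k χ)) (le_max_right _ _)]
    exact hmono (le_max_left _ _) χ
  have hdeg : ∀ χ : K[X], χ.Monic → χ.natDegree = m → χ.degree = m := by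
    intro χ hχ hd
    rw [degree_eq_natDegree hχ.ne_zero, hd]
  -- The rise past `i₀` makes `χ` a tangent direction of some `ρ i`, so that augmentations along `χ`
  -- exist.
  let X : Set K[X] := {χ | χ.Monic ∧ χ.natDegree = m ∧ ∃ i j, i₀ ≤ i ∧ i < j ∧ ρ i χ < ρ j χ}
  have hX : ∀ {i j : ι}, i₀ ≤ i → i < j → ∀ {φ : K[X]}, φ ∈ tangentDirection (ρ i) (ρ j) →
      φ ∈ X := fun hi hij _ h => ⟨h.1, htan hi hij h, _, _, hi, hij, h.2.1⟩
  have hζ : ∀ χ ∈ X, ∃ θ : Node v, IsTruncation (ρ i₀) χ (γ χ) θ ∧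
      (∃ μ : Node v, μ < θ ∧ χ ∈ tangentDirection μ θ) ∧
      ∃ η : Node v, θ < η ∧ χ ∈ tangentDirection θ η := by
    rintro χ ⟨hχ, hd, i, j, hi, hij, hlt⟩
    have hd' := hdeg χ hχ hd
    have h : χ ∈ tangentDirection (ρ i) (ρ j) := by
      refine mem_tangentDirection_of hχ hlt fun r hr => ?_
      rw [hd'] at hr
      rw [hagree i hi r hr, hagree j (hi.trans hij.le) r hr]
    have hγi : ρ i χ < γ χ := hlt.trans_le (hγle χ hχ hd j)
    have h1 := isTruncation_augmentation (hfam.strictMono hij) h hγi.le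
    -- The value `∞` provides a node above `θ` for every `χ`, with tangent direction `χ`.
    have h2 := isTruncation_augmentation (hfam.strictMono hij) h (le_top : ρ i χ ≤ ⊤)
    set θ := augmentation (hfam.strictMono hij) h hγi.le
    set η := augmentation (hfam.strictMono hij) h (le_top : ρ i χ ≤ ⊤)
    have hlow : ∀ r : K[X], r.degree < χ.degree → ρ i r = ρ i₀ r := fun r hr =>
      hagree i hi r (hr.trans_eq hd')
    have hθ : ρ i χ < θ χ := by rwa [h1.val_self]
    have hη : θ χ < η χ := by
      rw [h1.val_self, h2.val_self]
      exact WithTop.coe_lt_top _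
    refine ⟨θ, h1.congr hlow, ⟨ρ i, lt_of_le_of_ne ?_ ?_, ?_⟩, η, lt_of_le_of_ne ?_ ?_, ?_⟩
    · exact (isTruncation_self (hmono hij.le) h).le_of_le (fun r hr => (h1.val_eq hr).ge) hθ.le
    · intro heq
      rw [← heq] at hθ
      exact lt_irrefl _ hθ
    · exact mem_tangentDirection_of hχ hθ fun r hr => (h1.val_eq hr).symm
    · exact h1.le_of_le (fun r hr => (h2.val_eq hr).ge) (by rw [h2.val_self]; exact le_top)
    · intro heq
      rw [← heq] at hη
      exact lt_irrefl _ hη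
    · exact mem_tangentDirection_of hχ hη fun r hr => by rw [h1.val_eq hr, h2.val_eq hr]
  have : Nonempty (Node v) := ⟨ρ i₀⟩
  choose! ζ hζ1 hζ2 hζ3 using hζ
  refine ⟨ρ i₀, X, γ, ζ, ⟨fun χ h => h.2.1, hζ1, hζ2, hζ3, ?_, ?_⟩, ?_, ?_, ?_⟩
  · rintro χ h χ' h' hlt
    set l := max (k χ) (k χ')
    have e1 := hγ χ h.1 h.2.1 l (le_max_left _ _)
    have e2 := hγ χ' h'.1 h'.2.1 l (le_max_right _ _)
    have hl : i₀ ≤ l := (hk χ h.1 h.2.1).trans (le_max_left _ _)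
    rw [← hagree l hl, ← e1]
    · refine AddValuation.map_sub_eq_of_lt_right _ ?_
      rw [e1, e2]
      exact WithTop.coe_lt_coe.2 hlt
    · rw [← hdeg χ h.1 h.2.1]
      exact degree_sub_lt_of_monic h.1 h'.1 (by rw [h.2.1, h'.2.1])
  · intro χ h
    have hk₀ := hk χ h.1 h.2.1
    obtain ⟨l, hl⟩ := hfam.no_max (k χ)
    obtain ⟨χ', ht⟩ := tangentDirection_nonempty (hfam.strictMono hl)
    have h' := hX hk₀ hl ht
    refine ⟨χ', h', ?_⟩
    -- `χ` has stopped growing at `k χ` while `χ'` still rises. If `γ χ' ≤ γ χ`, then `χ' - χ` has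
    -- the value of `χ'` at `k χ`, and this fixed value would bound `χ'` at `l`.
    by_contra! hcon
    have e1 := hγ χ h.1 h.2.1 _ le_rfl
    have e2 := hγ χ h.1 h.2.1 l hl.le
    have h1 : ρ l χ' ≤ ρ l χ := by
      rw [e2]
      exact (hγle χ' h'.1 h'.2.1 l).trans (WithTop.coe_le_coe.2 hcon)
    have h2 : ρ (k χ) χ' < ρ (k χ) χ := by
      rw [e1, ← e2]
      exact ht.2.1.trans_le h1
    have hd := degree_sub_lt_of_monic h.1 h'.1 (by rw [h.2.1, h'.2.1])
    rw [hdeg χ h.1 h.2.1] at hd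
    have h3 : ρ l (χ' - χ) = ρ (k χ) χ' := by
      rw [hagree l (hk₀.trans hl.le) _ hd, ← hagree _ hk₀ _ hd]
      exact AddValuation.map_sub_eq_of_lt_left _ h2
    have h4 : ρ l χ' ≤ ρ l (χ' - χ) := AddValuation.map_le_sub _ le_rfl h1
    rw [h3] at h4
    exact absurd ht.2.1 (not_lt.2 h4)
  · obtain ⟨l, hl⟩ := hfam.no_max i₀
    obtain ⟨χ', ht⟩ := tangentDirection_nonempty (hfam.strictMono hl)
    exact ⟨χ', hX le_rfl hl ht⟩
  · intro i
    obtain ⟨l, hl⟩ := hfam.no_max (max i i₀)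
    obtain ⟨χ, ht⟩ := tangentDirection_nonempty (hfam.strictMono hl)
    have h := hX (le_max_right _ _) hl ht
    refine ⟨χ, h, (hmono (le_max_left i i₀)).trans ?_⟩
    -- The node is itself a truncation at its tangent direction `χ`, with a value at most `γ χ`.
    refine (isTruncation_self (hmono hl.le) ht).le_of_le (fun r hr => ?_) ?_
    · rw [(hζ1 χ h).val_eq hr,
        hagree _ (le_max_right _ _) r (hr.trans_eq (hdeg χ h.1 h.2.1))]
    · rw [(hζ1 χ h).val_self]
      exact hγle χ h.1 h.2.1 _
  · intro χ h
    refine ⟨k χ, (hζ1 χ h).le_of_le (fun r hr => ?_) (hγ χ h.1 h.2.1 _ le_rfl).ge⟩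
    exact (hagree _ (hk χ h.1 h.2.1) r (hr.trans_eq (hdeg χ h.1 h.2.1))).ge

end Families

end

end ValTree

theorem lemma4p9 {K : Type u} {Λ : Type w} [Field K] [AddCommGroup Λ] [LinearOrder Λ]
    [IsOrderedAddMonoid Λ] (v : AddValuation K (WithTop Λ))
    {A : Type*} [LinearOrder A] (ρ : A → ValTree.Node v) (m : ℕ)
    (hρ : ValTree.IsContinuousFamily ρ m) (hm : (m : ℕ∞) < ValTree.unstableDegree ρ) :
    ∃ (B : Type (max u w)) (_ : LinearOrder B) (ζ : B → ValTree.Node v),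
      ValTree.IsContinuousFamily ζ m ∧ ValTree.FamilyEquiv ρ ζ ∧
      (WellFoundedLT B ∧ ∀ j, ValTree.deg (ζ j) = m) ∧
      (∀ j, ValTree.relRamificationIndex (ζ j) = 1) ∧
      (∀ j, (ValTree.valueGroup (ζ j) : Set Λ) = ValTree.stableGroup ζ) ∧
      ∃ χ : B → Polynomial K, (∀ j, χ j ∈ ValTree.minKP (ζ j)) ∧
        ∀ j k, j < k → ¬ ValTree.MuEquiv (ζ j) (χ j) (χ k) ∧
          ValTree.IsAugmentation (ζ j) (χ k) (ValTree.sv (ζ k)) (ζ k) := by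
  obtain ⟨w, X, γ, ζ, S, ⟨χ₀, hχ₀⟩, hcof₁, hcof₂⟩ := ValTree.exists_isTruncationSystem hρ hm
  -- The values are well-ordered rather than the polynomials, as `γ` need not be injective; one `χ`
  -- is then chosen for each value.
  obtain ⟨s, hs, hwf⟩ := ValTree.exists_wellFoundedLT_isCofinal (γ '' X)
  let χ : ULift.{u} s → Polynomial K := fun b => b.down.1.2.choose
  have hχ : ∀ b, χ b ∈ X := fun b => b.down.1.2.choose_spec.1
  have hγ : ∀ b, γ (χ b) = b.down.1.1 := fun b => b.down.1.2.choose_spec.2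
  have hlt : ∀ b c, b < c → γ (χ b) < γ (χ c) := fun b c h => by
    rw [hγ, hγ]
    exact h
  have hcof : ∀ ψ ∈ X, ∃ b, γ ψ < γ (χ b) := by
    intro ψ hψ
    obtain ⟨ψ', hψ', h⟩ := S.no_max ψ hψ
    obtain ⟨g, hg, hle⟩ := hs ⟨γ ψ', ψ', hψ', rfl⟩
    refine ⟨⟨⟨g, hg⟩⟩, ?_⟩
    rw [hγ]
    exact h.trans_le hle
  have hno : ∀ b : ULift.{u} s, ∃ c, b < c := by
    intro b
    obtain ⟨c, hc⟩ := hcof (χ b) (hχ b)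
    rw [hγ, hγ] at hc
    exact ⟨c, hc⟩
  have hfam : ValTree.IsTotallyOrderedFamily fun b => ζ (χ b) :=
    ⟨fun b c h => S.lt_of_lt (hχ b) (hχ c) (hlt b c h), fun b => S.isInner (hχ b), hno⟩
  obtain ⟨b₀, -⟩ := hcof χ₀ hχ₀
  refine ⟨ULift.{u} s, inferInstance, fun b => ζ (χ b), ⟨hfam, b₀, fun b _ => S.deg_eq (hχ b)⟩,
    ⟨fun i => ?_, fun b => hcof₂ _ (hχ b)⟩, ⟨inferInstance, fun b => S.deg_eq (hχ b)⟩,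
    fun b => AddSubgroup.relIndex_eq_one.2 (S.valueGroup_le (hχ b)), fun b => ?_,
    χ, fun b => S.mem_minKP (hχ b), fun b c h => ⟨S.not_muEquiv (hχ b) (hχ c) (hlt b c h),
      S.isAugmentation (hχ b) (hχ c) (hlt b c h)⟩⟩
  · obtain ⟨ψ, hψ, hle⟩ := hcof₁ i
    obtain ⟨b, hb⟩ := hcof ψ hψ
    exact ⟨b, hle.trans (S.lt_of_lt hψ (hχ b) hb).le⟩
  · ext g
    rw [SetLike.mem_coe]
    constructor
    · intro hg
      obtain ⟨a, ha0, ha, hag⟩ := (S.mem_valueGroup_iff (hχ b)).1 hg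
      obtain ⟨c, hc⟩ := hno b
      have ht := S.mem_tangentDirection (hχ b) (hχ c) (hlt b c hc)
      -- Polynomials of degree `< m` are stable by minimality of key polynomials, and their value is
      -- constant on the chain.
      refine ⟨a, ⟨ha0, b, χ c, Set.mem_iUnion₂.2 ⟨c, hc, ht⟩, ?_⟩, ⟨b, ?_⟩, ?_⟩
      · exact (ValTree.tangentDirection_subset_KP (hfam.strictMono hc) ht).2.1 a ha0
          (ha.trans_eq (S.degree_eq (hχ c)).symm)
      · exact (S.val_eq (hχ b) ha).trans hag
      · rintro _ ⟨c, rfl⟩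
        exact ((S.val_eq (hχ c) ha).trans hag).le
    -- A stable value is attained at some `ζ (χ c)`, whose value group is that of `ζ (χ b)`.
    · rintro ⟨f, -, ⟨c, hc⟩, -⟩
      rw [S.mem_valueGroup_iff (hχ b), ← S.mem_valueGroup_iff (hχ c)]
      exact AddSubgroup.subset_closure ⟨f, hc⟩
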